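/- For $|x|<1$ (and, if $r\ge 2$, for $|x|=1$) let $\mathrm{Li}_r(x)=\sum_{n\ge1}x^n/n^r$. For $\tau\in\mathbb H$, $q=e^{2\pi i\tau}$, $\zeta=e^{2\pi i z}$ and odd $r$ let $$\mathcal{L}i_r(\zeta,q)=\sum_{n=0}^\infty \mathrm{Li}_r(q^n\zeta)+\sum_{n=1}^\infty \mathrm{Li}_r(q^n\zeta^{-1})-\sum_{j=0}^r\frac{B_{j+1}}{(r-j)!\,(j+1)!}(\log\zeta)^{r-j}(\log q)^j,$$ where $\log\zeta=2\pi i z$, $\log q=2\pi i\tau$, and the $B_k$ are the Bernoulli numbers with $B_1=-\tfrac12$. Let $$f(z,\tau)=\frac1{(2\pi i)^3}\bigl\{\mathcal{L}i_3(e^{2\pi i z},q)-\mathcal{L}i_3(1,q)\bigr\},$$ given by these series for $0<\operatorname{Im}z<\operatorname{Im}\tau$. Then $f$ extends by analytic continuation along every path in $\{(z,\tau):\tau\in\mathbb H,\ z\in\mathbb C\setminus(\mathbb Z+\mathbb Z\tau)\}$ that starts in this domain, and at every point $(z,\tau)$ of this set every branch of $f$ so obtained satisfies $$f^{(3,0)}f^{(1,2)}-\bigl(f^{(2,1)}\bigr)^2+\tfrac13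 f^{(0,3)}=-\tfrac1{144}E_4(\tau),$$ where $f^{(n,m)}=\partial^{n+m}f/\partial z^n\partial\tau^m$ and $E_4(\tau)=1+240\sum_{n\ge1}\sigma_3(n)q^n$ with $\sigma_3(n)=\sum_{d\mid n}d^3$. -/

import Mathlib

noncomputable section

namespace EllipticTrilog

open Complex Topology

/-- The polylogarithm series `Li_r(x) = ∑_{n ≥ 1} xⁿ / nʳ`. It converges for `|x| < 1`, and for
`r ≥ 2` also for `|x| = 1`. -/
def Li (r : ℕ) (x : ℂ) : ℂ := ∑' n : ℕ, x ^ (n + 1) / ((n : ℂ) + 1) ^ r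

/-- The regularizing polynomial
`χ_r = ∑_{j=0}^r B_{j+1} / ((r-j)! (j+1)!) (log ζ)^(r-j) (log q)^j`,
as a function of `logζ` and `logq`. Mathlib's `bernoulli` has `B₁ = -1/2`. -/
def chi (r : ℕ) (logζ logq : ℂ) : ℂ :=
  ∑ j ∈ Finset.range (r + 1),
    ((bernoulli (j + 1) : ℚ) : ℂ) / ((r - j).factorial * (j + 1).factorial : ℂ)
      * logζ ^ (r - j) * logq ^ j

/-- The elliptic polylogarithm `𝓛i_r(ζ, q)`, `r` odd, at `ζ = exp (2πiz)`, `q = exp (2πiτ)`, with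
`log ζ = 2πiz` and `log q = 2πiτ`. -/
def ellipticLi (r : ℕ) (z τ : ℂ) : ℂ :=
  (∑' n : ℕ, Li r (exp (2 * Real.pi * I * τ) ^ n * exp (2 * Real.pi * I * z)))
    + (∑' n : ℕ, Li r (exp (2 * Real.pi * I * τ) ^ (n + 1) * (exp (2 * Real.pi * I * z))⁻¹))
    - chi r (2 * Real.pi * I * z) (2 * Real.pi * I * τ)

/-- The normalized elliptic trilogarithm
`f(z, τ) = (2πi)⁻³ (𝓛i₃(exp (2πiz), q) - 𝓛i₃(1, q))`, given by its defining series. On `strip`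
all polylogarithms in the first term have arguments in the open unit disc; elsewhere `f` is
understood by analytic continuation. -/
def fSeries (p : ℂ × ℂ) : ℂ :=
  (1 / (2 * Real.pi * I) ^ 3) * (ellipticLi 3 p.1 p.2 - ellipticLi 3 0 p.2)

/-- The set of `(z, τ)` with `0 < Im z < Im τ`, that is `|q| < |ζ| < 1`. -/
def strip : Set (ℂ × ℂ) := {p | 0 < p.1.im ∧ p.1.im < p.2.im}

/-- The set of `(z, τ)` with `τ` in the upper half plane and `z` not in the lattice `ℤ + ℤτ`, that
is, no argument `qⁿ ζ` (`n ∈ ℤ`) equals the branch point `1`. -/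
def offLattice : Set (ℂ × ℂ) :=
  {p | 0 < p.2.im ∧ ∀ m n : ℤ, p.1 ≠ (m : ℂ) + (n : ℂ) * p.2}

/-- `F` is an analytic continuation, along the path `γ`, of the germ of `g` at `γ 0`: a family of
germs `F t` of analytic functions at `γ t`, starting with the germ of `g`, and locally coherent. -/
structure IsContinuationAlong (g : ℂ × ℂ → ℂ) (γ : C(unitInterval, ℂ × ℂ))
    (F : unitInterval → ℂ × ℂ → ℂ) : Prop where
  start : F 0 =ᶠ[𝓝 (γ 0)] g
  analyticAt : ∀ t, AnalyticAt ℂ (F t) (γ t)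
  coherent : ∀ t, ∀ᶠ s in 𝓝 t, F s =ᶠ[𝓝 (γ s)] F t

/-- `g` represents a branch at `p` of the multivalued analytic function `f`: its germ at `p` is
obtained from the defining series on `strip` by analytic continuation along a path that ends at `p`
and along which `z` avoids the lattice. -/
def IsBranch (g : ℂ × ℂ → ℂ) (p : ℂ × ℂ) : Prop :=
  ∃ (γ : C(unitInterval, ℂ × ℂ)) (F : unitInterval → ℂ × ℂ → ℂ),
    γ 0 ∈ strip ∧ (∀ t, γ t ∈ offLattice) ∧ γ 1 = p ∧
      IsContinuationAlong fSeries γ F ∧ F 1 =ᶠ[𝓝 p] g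

/-- The partial derivative `g^{(n,m)} = ∂^{n+m} g / ∂zⁿ ∂τᵐ`. -/
def partialDeriv (n m : ℕ) (g : ℂ × ℂ → ℂ) (z τ : ℂ) : ℂ :=
  iteratedDeriv n (fun w => iteratedDeriv m (fun s => g (w, s)) τ) z

end EllipticTrilog

end

/-!
On the strip the third derivatives of `f` are Laurent series in `ζ`. Put `Pᵣ(x) = ∑_m mʳ xᵐ`, a rational
function of `x` (`eulerian`). Expanding the polylogarithms on the strip `|q| < |ζ| < 1` and
differentiating the resulting exponential series term by term gives
`f^{(3-r, r)} = ∑_{j ∈ ℤ} Pᵣ(qʲ) ζʲ`, where the terms with `j = 0` are replaced by the constants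
`1/2`, `-1/12`, `0` and `-2 ∑_{k ≥ 1} P₃(qᵏ)` that come from the regularizing polynomial and from
the subtracted value at `ζ = 1` (`hasSum_laurent_partialOp`, `pdeDefect_fSeries`).

The differential equation is therefore an identity between Laurent series (`laurent_identity`),
checked coefficient by coefficient. For `m = j + k` with `j, k, m ≠ 0` the symmetrized product of
coefficients is, by partial fractions (`eulerian_addition`),
`(P₀(qʲ) P₂(qᵏ) + P₀(qᵏ) P₂(qʲ)) / 2 - P₁(qʲ) P₁(qᵏ) = (P₂(qʲ) + P₂(qᵏ)) / (2 (1 - qᵐ))`.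
Since `P₂(1/x) = -P₂(x)`, the sum of these over all `j` is zero apart from the terms with `j = 0` or
`k = 0`, and those cancel against the coefficient `P₃(qᵐ) / 3`. For `m = 0` the symmetrized product
is `-P₃(qʲ) / 2`, and the sum `∑_{k ≥ 1} P₃(qᵏ) = ∑ σ₃(n) qⁿ` produces `E₄`. This proves the
equation on the strip; it persists under analytic continuation by the identity theorem
(`pdeDefect_eventuallyEq_zero`).

The continuation exists because, along a given path, all but finitely many terms `Li₃(qⁿ ζ^{±1})`
keep their argument in the unit disc. These terms have an analytic sum, and each of the others
continues on its own: `Li₃(exp u)` is a threefold primitive of `exp u / (1 - exp u)`, which is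
holomorphic off `2πiℤ` (`continuesAlong_Li_exp`, `continuesAlong_trilogSum`). Analyticity in both
variables jointly is obtained by summing the Taylor series of exponentials
(`hasFPowerSeriesAt_expSum`).
-/

noncomputable section
namespace EllipticTrilog
open Complex Topology

/-! ### Absolutely convergent exponential series in several variables -/

section ExpSum

variable {ι E : Type*} [NormedAddCommGroup E] [NormedSpace ℂ E]

/-- The exponential series `∑ᵢ cᵢ exp (Lᵢ v)`, with linear functionals `Lᵢ` as exponents. -/
def expSum (c : ι → ℂ) (L : ι → E →L[ℂ] ℂ) (v : E) : ℂ := ∑' i, c i * exp (L i v)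

/-- Absolute convergence of `expSum c L`, uniform on some ball around `v`: the supremum of
`|exp (Lᵢ w)|` over the ball of radius `r` is at most `exp (re (Lᵢ v) + r ‖Lᵢ‖)`. -/
def ExpSummableAt (c : ι → ℂ) (L : ι → E →L[ℂ] ℂ) (v : E) : Prop :=
  ∃ r > 0, Summable fun i => ‖c i‖ * Real.exp ((L i v).re + r * ‖L i‖)

/-- The `n`-th Taylor coefficient of `v ↦ exp (l v)` at the origin, as a multilinear map. -/
def expTerm (l : E →L[ℂ] ℂ) (n : ℕ) : ContinuousMultilinearMap ℂ (fun _ : Fin n => E) ℂ :=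
  ((n.factorial : ℂ)⁻¹) •
    (ContinuousMultilinearMap.mkPiAlgebraFin ℂ n ℂ).compContinuousLinearMap fun _ => l

lemma expTerm_apply (l : E →L[ℂ] ℂ) (n : ℕ) (y : E) :
    expTerm l n (fun _ => y) = (l y) ^ n / n.factorial := by
  simp [expTerm, List.ofFn_const, div_eq_inv_mul]

lemma norm_expTerm_le (l : E →L[ℂ] ℂ) (n : ℕ) : ‖expTerm l n‖ ≤ ‖l‖ ^ n / n.factorial := by
  rw [expTerm, norm_smul, norm_inv, Complex.norm_natCast, div_eq_inv_mul]
  gcongr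
  refine (ContinuousMultilinearMap.norm_compContinuousLinearMap_le _ _).trans ?_
  simp only [Finset.prod_const, Finset.card_univ, Fintype.card_fin]
  calc _ ≤ 1 * ‖l‖ ^ n := by gcongr; simp
    _ = _ := one_mul _

lemma summable_expSum_double {c : ι → ℂ} {L : ι → E →L[ℂ] ℂ} {v : E} {r : ℝ} (hr : 0 ≤ r)
    (h : Summable fun i => ‖c i‖ * Real.exp ((L i v).re + r * ‖L i‖)) :
    Summable fun p : ι × ℕ => ‖c p.1 * exp (L p.1 v)‖ * (‖L p.1‖ ^ p.2 / p.2.factorial * r ^ p.2) := by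
  have key (i : ι) : HasSum
      (fun n : ℕ => ‖c i * exp (L i v)‖ * (‖L i‖ ^ n / n.factorial * r ^ n))
      (‖c i‖ * Real.exp ((L i v).re + r * ‖L i‖)) := by
    have := (NormedSpace.expSeries_div_hasSum_exp (r * ‖L i‖)).mul_left ‖c i * exp (L i v)‖
    rw [← Real.exp_eq_exp_ℝ] at this
    convert! this using 1
    · ext n; rw [mul_pow]; ring
    · rw [norm_mul, Complex.norm_exp, Real.exp_add]; ring
  refine (summable_prod_of_nonneg fun p => by positivity).2 ⟨fun i => (key i).summable, ?_⟩
  simpa only [(key _).tsum_eq] using h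

/-- The Taylor series at `v` of an exponential series. -/
def expSumSeries (c : ι → ℂ) (L : ι → E →L[ℂ] ℂ) (v : E) : FormalMultilinearSeries ℂ E ℂ :=
  fun n => ∑' i, (c i * exp (L i v)) • expTerm (L i) n

lemma summable_norm_smul_expTerm {c : ι → ℂ} {L : ι → E →L[ℂ] ℂ} {v : E}
    (h : ExpSummableAt c L v) (n : ℕ) :
    Summable fun i => ‖(c i * exp (L i v)) • expTerm (L i) n‖ := by
  obtain ⟨r, hr, h⟩ := h
  have h1 := (summable_expSum_double hr.le h).prod_symm.prod_factor n
  have h2 := h1.mul_right ((r ^ n)⁻¹)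
  refine h2.of_nonneg_of_le (fun i => by positivity) fun i => ?_
  have : 0 < r ^ n := by positivity
  rw [norm_smul]
  simp only [Prod.swap_prod_mk]
  rw [← mul_assoc, mul_inv_cancel_right₀ this.ne']
  gcongr
  exact norm_expTerm_le _ _

/-- Exponential series are analytic in several variables: the Taylor series of the terms can be
summed, because the double series of their norms converges. -/
lemma hasFPowerSeriesAt_expSum {c : ι → ℂ} {L : ι → E →L[ℂ] ℂ} {v : E}
    (h : ExpSummableAt c L v) :
    HasFPowerSeriesAt (expSum c L) (expSumSeries c L v) v := by
  have hterm := summable_norm_smul_expTerm h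
  obtain ⟨r, hr, h⟩ := h
  have hd := summable_expSum_double hr.le h
  refine ⟨ENNReal.ofReal r, ?_, by simpa using hr, ?_⟩
  · rw [ENNReal.ofReal]
    refine FormalMultilinearSeries.le_radius_of_summable _ ?_
    rw [Real.coe_toNNReal _ hr.le]
    refine hd.prod_symm.prod.of_nonneg_of_le (fun n => by positivity) fun n => ?_
    have h1 := hd.prod_symm.prod_factor n
    calc ‖expSumSeries c L v n‖ * r ^ n
        ≤ (∑' i, ‖(c i * exp (L i v)) • expTerm (L i) n‖) * r ^ n := by
          gcongr; exact norm_tsum_le_tsum_norm (hterm n)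
      _ = ∑' i, ‖(c i * exp (L i v)) • expTerm (L i) n‖ * r ^ n := tsum_mul_right.symm
      _ ≤ _ := by
          refine Summable.tsum_le_tsum (fun i => ?_) ((hterm n).mul_right _) h1
          rw [norm_smul, mul_assoc]
          simp only [Prod.swap_prod_mk]
          gcongr
          exact norm_expTerm_le _ _
  · intro y hy
    have hy' : ‖y‖ < r := by
      rwa [Metric.eball_ofReal, mem_ball_zero_iff] at hy
    have hs : Summable fun p : ι × ℕ =>
        c p.1 * exp (L p.1 v) * ((L p.1 y) ^ p.2 / p.2.factorial) := by
      refine Summable.of_norm_bounded hd fun p => ?_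
      rw [norm_mul, norm_div, norm_pow, Complex.norm_natCast]
      gcongr
      rw [div_mul_eq_mul_div, ← mul_pow]
      gcongr
      exact ((L p.1).le_opNorm y).trans (by gcongr)
    have hrow (i : ι) : HasSum (fun n : ℕ => c i * exp (L i v) * ((L i y) ^ n / n.factorial))
        (c i * exp (L i (v + y))) := by
      have := (NormedSpace.expSeries_div_hasSum_exp (L i y)).mul_left (c i * exp (L i v))
      rwa [← Complex.exp_eq_exp_ℂ, mul_assoc (c i), ← Complex.exp_add, ← map_add] at this
    have hcol (n : ℕ) : HasSum (fun i => c i * exp (L i v) * ((L i y) ^ n / n.factorial))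
        (expSumSeries c L v n fun _ => y) := by
      have := (hterm n).of_norm.hasSum.mapL
        (ContinuousMultilinearMap.apply ℂ (fun _ : Fin n => E) ℂ fun _ => y)
      simpa [expTerm_apply, expSumSeries] using this
    have htot := hs.hasSum
    have e1 := (htot.prod_fiberwise hrow).tsum_eq
    have hswap : HasSum (fun p : ℕ × ι =>
        c p.2 * exp (L p.2 v) * ((L p.2 y) ^ p.1 / p.1.factorial)) _ :=
      (Equiv.prodComm ℕ ι).hasSum_iff.2 htot
    have e2 := hswap.prod_fiberwise hcol
    rw [expSum, e1]
    exact e2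

lemma analyticAt_expSum {c : ι → ℂ} {L : ι → E →L[ℂ] ℂ} {v : E} (h : ExpSummableAt c L v) :
    AnalyticAt ℂ (expSum c L) v :=
  (hasFPowerSeriesAt_expSum h).analyticAt

lemma ExpSummableAt.summable {c : ι → ℂ} {L : ι → E →L[ℂ] ℂ} {v : E} (h : ExpSummableAt c L v) :
    Summable fun i => c i * exp (L i v) := by
  obtain ⟨r, hr, h⟩ := h
  refine Summable.of_norm_bounded h fun i => ?_
  rw [norm_mul, Complex.norm_exp]
  gcongr
  have : 0 ≤ r * ‖L i‖ := by positivity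
  linarith

lemma ExpSummableAt.eventually {c : ι → ℂ} {L : ι → E →L[ℂ] ℂ} {v : E}
    (h : ExpSummableAt c L v) : ∀ᶠ w in 𝓝 v, ExpSummableAt c L w := by
  obtain ⟨r, hr, h⟩ := h
  filter_upwards [Metric.ball_mem_nhds v (half_pos hr)] with w hw
  refine ⟨r / 2, half_pos hr, h.of_nonneg_of_le (fun i => by positivity) fun i => ?_⟩
  gcongr ‖c i‖ * Real.exp ?_
  have h1 : (L i w).re - (L i v).re ≤ ‖L i‖ * (r / 2) := by
    rw [← Complex.sub_re, ← map_sub]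
    refine (Complex.re_le_norm _).trans (((L i).le_opNorm _).trans ?_)
    gcongr
    rw [← dist_eq_norm]
    exact (Metric.mem_ball.1 hw).le
  linarith

lemma ExpSummableAt.mul_apply {c : ι → ℂ} {L : ι → E →L[ℂ] ℂ} {v : E}
    (h : ExpSummableAt c L v) (w : E) : ExpSummableAt (fun i => c i * L i w) L v := by
  obtain ⟨r, hr, h⟩ := h
  refine ⟨r / 2, half_pos hr, (h.mul_left (‖w‖ * (2 / r))).of_nonneg_of_le
    (fun i => by positivity) fun i => ?_⟩
  have h1 : ‖L i‖ ≤ 2 / r * Real.exp (r / 2 * ‖L i‖) := by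
    have := Real.add_one_le_exp (r / 2 * ‖L i‖)
    calc ‖L i‖ = 2 / r * (r / 2 * ‖L i‖) := by field_simp
      _ ≤ _ := by gcongr; linarith
  have h2 : ‖L i w‖ ≤ ‖L i‖ * ‖w‖ := (L i).le_opNorm w
  calc ‖c i * L i w‖ * Real.exp ((L i v).re + r / 2 * ‖L i‖)
      ≤ ‖c i‖ * ((2 / r * Real.exp (r / 2 * ‖L i‖)) * ‖w‖) *
          Real.exp ((L i v).re + r / 2 * ‖L i‖) := by
        rw [norm_mul]; gcongr; exact h2.trans (by gcongr)
    _ = ‖w‖ * (2 / r) * (‖c i‖ * (Real.exp (r / 2 * ‖L i‖) *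
          Real.exp ((L i v).re + r / 2 * ‖L i‖))) := by ring
    _ = _ := by rw [← Real.exp_add]; ring_nf

/-- Exponential series are differentiated term by term. -/
lemma fderiv_expSum_apply {c : ι → ℂ} {L : ι → E →L[ℂ] ℂ} {v : E} (h : ExpSummableAt c L v)
    (w : E) : fderiv ℂ (expSum c L) v w = expSum (fun i => c i * L i w) L v := by
  rw [(hasFPowerSeriesAt_expSum h).fderiv_eq, continuousMultilinearCurryFin1_apply]
  have := (summable_norm_smul_expTerm h 1).of_norm.hasSum.mapL
    (ContinuousMultilinearMap.apply ℂ (fun _ : Fin 1 => E) ℂ fun _ => w)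
  have e : (fun i : Fin 1 => w) = Fin.snoc 0 w := by ext i; simp [Fin.snoc]
  rw [← e]
  refine (this.tsum_eq.symm.trans ?_)
  rw [expSum]
  refine tsum_congr fun i => ?_
  simp [expTerm_apply]
  ring

end ExpSum

/-! ### Analytic continuation along paths -/

section Continuation

variable {E : Type*} [NormedAddCommGroup E] [NormedSpace ℂ E]

/-- The germ of `g` at `γ 0` can be continued analytically along `γ`. On `E = ℂ × ℂ` this says
that `IsContinuationAlong g γ F` holds for some `F`. -/
def ContinuesAlong (g : E → ℂ) (γ : C(unitInterval, E)) : Prop :=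
  ∃ F : unitInterval → E → ℂ, F 0 =ᶠ[𝓝 (γ 0)] g ∧ (∀ t, AnalyticAt ℂ (F t) (γ t)) ∧
    ∀ t, ∀ᶠ s in 𝓝 t, F s =ᶠ[𝓝 (γ s)] F t

lemma ContinuesAlong.congr {g g' : E → ℂ} {γ : C(unitInterval, E)} (h : ContinuesAlong g γ)
    (hg : g =ᶠ[𝓝 (γ 0)] g') : ContinuesAlong g' γ := by
  obtain ⟨F, h0, h1, h2⟩ := h
  exact ⟨F, h0.trans hg, h1, h2⟩

lemma continuesAlong_of_analyticAt {g : E → ℂ} {γ : C(unitInterval, E)}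
    (h : ∀ t, AnalyticAt ℂ g (γ t)) : ContinuesAlong g γ :=
  ⟨fun _ => g, .rfl, h, fun _ => .of_forall fun _ => .rfl⟩

lemma ContinuesAlong.add {g g' : E → ℂ} {γ : C(unitInterval, E)} (h : ContinuesAlong g γ)
    (h' : ContinuesAlong g' γ) : ContinuesAlong (fun v => g v + g' v) γ := by
  obtain ⟨F, h0, h1, h2⟩ := h
  obtain ⟨F', h0', h1', h2'⟩ := h'
  refine ⟨fun t v => F t v + F' t v, h0.add h0', fun t => (h1 t).add (h1' t), fun t => ?_⟩
  filter_upwards [h2 t, h2' t] with s hs hs' using hs.add hs'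

lemma ContinuesAlong.const_mul {g : E → ℂ} {γ : C(unitInterval, E)} (h : ContinuesAlong g γ)
    (a : ℂ) : ContinuesAlong (fun v => a * g v) γ := by
  obtain ⟨F, h0, h1, h2⟩ := h
  refine ⟨fun t v => a * F t v, h0.fun_comp (a * ·), fun t => analyticAt_const.mul (h1 t),
    fun t => ?_⟩
  filter_upwards [h2 t] with s hs using hs.fun_comp (a * ·)

/-- Continuations can be pulled back along linear maps. -/
lemma ContinuesAlong.comp_clm {E' : Type*} [NormedAddCommGroup E'] [NormedSpace ℂ E']
    {g : E → ℂ} (T : E' →L[ℂ] E) {γ : C(unitInterval, E')}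
    (h : ContinuesAlong g ((⟨T, T.continuous⟩ : C(E', E)).comp γ)) :
    ContinuesAlong (fun v => g (T v)) γ := by
  obtain ⟨F, h0, h1, h2⟩ := h
  have hT (t) : Filter.Tendsto T (𝓝 (γ t)) (𝓝 (T (γ t))) := T.continuous.continuousAt
  refine ⟨fun t v => F t (T v), (hT 0).eventually h0, fun t => ?_, fun t => ?_⟩
  · exact AnalyticAt.comp (h1 t) (T.analyticAt _)
  · filter_upwards [h2 t] with s hs using (hT s).eventually hs

/-- A germ can be continued along `γ` if it belongs to a class `P` of analytic germs such that each
point of `γ` has an open neighbourhood `V` to which all germs of class `P` at points of `V`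
extend. -/
lemma continuesAlong_of_local_extension {P : E → (E → ℂ) → Prop} {γ : C(unitInterval, E)}
    (hP : ∀ p g, P p g → AnalyticAt ℂ g p)
    (hext : ∀ t, ∃ V, IsOpen V ∧ γ t ∈ V ∧ ∀ p ∈ V, ∀ g, P p g →
      ∃ G, G =ᶠ[𝓝 p] g ∧ ∀ p' ∈ V, P p' G)
    {g : E → ℂ} (hg : P (γ 0) g) : ContinuesAlong g γ := by
  choose V hVo hVm hV using hext
  obtain ⟨τ, hτ0, hτm, ⟨N, hN⟩, hτ⟩ := exists_monotone_Icc_subset_open_cover_unitInterval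
    (c := fun t => γ ⁻¹' V t) (fun t => (hVo t).preimage γ.continuous)
    (fun t _ => Set.mem_iUnion.2 ⟨t, hVm t⟩)
  have key (n : ℕ) : ∃ F : unitInterval → E → ℂ, F 0 =ᶠ[𝓝 (γ 0)] g ∧
      (∀ t ≤ τ n, P (γ t) (F t)) ∧
      ∀ t ≤ τ n, ∀ᶠ s in 𝓝 t, s ≤ τ n → F s =ᶠ[𝓝 (γ s)] F t := by
    induction n with
    | zero =>
      refine ⟨fun _ => g, .rfl, fun t ht => ?_, fun t ht => .of_forall fun s _ => .rfl⟩
      rw [hτ0] at ht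
      rwa [le_antisymm ht t.2.1]
    | succ n ih =>
      obtain ⟨F, h0, h1, h2⟩ := ih
      obtain ⟨i, hi⟩ := hτ n
      have hle : τ n ≤ τ (n + 1) := hτm n.le_succ
      obtain ⟨G, hG, hGP⟩ := hV i (γ (τ n)) (hi ⟨le_rfl, hle⟩) (F (τ n)) (h1 _ le_rfl)
      have hγ : Filter.Tendsto γ (𝓝 (τ n)) (𝓝 (γ (τ n))) := γ.continuous.continuousAt
      refine ⟨fun t => if t ≤ τ n then F t else G, ?_, fun t ht => ?_, fun t ht => ?_⟩
      · simpa [show (0 : unitInterval) ≤ τ n from (τ n).2.1] using h0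
      · by_cases h : t ≤ τ n
        · simpa [h] using h1 t h
        · simpa [h] using hGP _ (hi ⟨(not_le.1 h).le, ht⟩)
      · rcases lt_trichotomy t (τ n) with h | h | h
        · filter_upwards [h2 t h.le, Iio_mem_nhds h] with s hs hs' _
          have hs' : s ≤ τ n := (Set.mem_Iio.1 hs').le
          simpa [h.le, hs'] using hs hs'
        · subst h
          filter_upwards [h2 _ le_rfl, hγ.eventually hG.eventually_nhds] with s hs hs' _
          by_cases h : s ≤ τ n
          · simpa [h] using hs h
          · simp only [h, if_false, le_refl, if_true]
            exact hs'
        · filter_upwards [Ioi_mem_nhds h] with s hs _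
          simp [not_le.2 h, not_le.2 (Set.mem_Ioi.1 hs)]
  obtain ⟨F, h0, h1, h2⟩ := key N
  rw [hN N le_rfl] at h1 h2
  refine ⟨F, h0, fun t => hP _ _ (h1 t t.2.2), fun t => ?_⟩
  filter_upwards [h2 t t.2.2] with s hs using hs s.2.2

end Continuation

/-- On a disc, the germ of an iterated primitive of a holomorphic function extends to an iterated
primitive on the whole disc. -/
lemma exists_extension_iteratedDeriv_eq (n : ℕ) {c p : ℂ} {r : ℝ} (hp : p ∈ Metric.ball c r)
    {h g : ℂ → ℂ} (hh : DifferentiableOn ℂ h (Metric.ball c r)) (hg : AnalyticAt ℂ g p)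
    (hgh : iteratedDeriv n g =ᶠ[𝓝 p] h) :
    ∃ G, DifferentiableOn ℂ G (Metric.ball c r) ∧ G =ᶠ[𝓝 p] g ∧
      Set.EqOn (iteratedDeriv n G) h (Metric.ball c r) := by
  induction n generalizing g with
  | zero => exact ⟨h, hh, by simpa using hgh.symm, by simp [Set.eqOn_refl]⟩
  | succ n ih =>
    rw [iteratedDeriv_succ'] at hgh
    obtain ⟨G₁, hG₁, hG₁g, hG₁h⟩ := ih hg.deriv hgh
    obtain ⟨G₀, hG₀⟩ := hG₁.isExactOn_ball
    have hder : ∀ z ∈ Metric.ball c r, HasDerivAt (fun w => G₀ w - G₀ p + g p) (G₁ z) z :=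
      fun z hz => ((hG₀ z hz).sub_const _).add_const _
    refine ⟨fun w => G₀ w - G₀ p + g p,
      fun z hz => (hder z hz).differentiableAt.differentiableWithinAt, ?_, fun z hz => ?_⟩
    · obtain ⟨ε, hε, hb⟩ := Metric.eventually_nhds_iff_ball.1
        (((Metric.isOpen_ball.eventually_mem hp).and hG₁g).and hg.eventually_analyticAt)
      refine Metric.eventually_nhds_iff_ball.2 ⟨ε, hε, fun z hz => ?_⟩
      have := (convex_ball p ε).is_const_of_fderivWithin_eq_zero (𝕜 := ℂ)
        (f := fun w => G₀ w - G₀ p + g p - g w) (fun w hw =>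
          ((hder w (hb w hw).1.1).differentiableAt.sub
            (hb w hw).2.differentiableAt).differentiableWithinAt) (fun w hw => ?_) hz
          (Metric.mem_ball_self hε)
      · linear_combination this
      · rw [fderivWithin_of_isOpen Metric.isOpen_ball hw]
        have h1 : HasDerivAt (fun w => G₀ w - G₀ p + g p - g w) _ w :=
          (hder w (hb w hw).1.1).sub (hb w hw).2.differentiableAt.hasDerivAt
        rw [(hb w hw).1.2, sub_self] at h1
        ext
        simpa using h1.deriv
    · have : deriv (fun w => G₀ w - G₀ p + g p) =ᶠ[𝓝 z] G₁ := by
        filter_upwards [Metric.isOpen_ball.mem_nhds hz] with w hw using (hder w hw).deriv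
      rw [iteratedDeriv_succ', this.iteratedDeriv_eq n]
      exact hG₁h hz

/-- Iterated primitives of a function holomorphic on an open set `U` continue along all paths
in `U`. -/
lemma continuesAlong_of_iteratedDeriv_eq (n : ℕ) {U : Set ℂ} (hU : IsOpen U) {h g : ℂ → ℂ}
    (hh : DifferentiableOn ℂ h U) {γ : C(unitInterval, ℂ)} (hγ : ∀ t, γ t ∈ U)
    (hg : AnalyticAt ℂ g (γ 0)) (hgh : iteratedDeriv n g =ᶠ[𝓝 (γ 0)] h) :
    ContinuesAlong g γ := by
  refine continuesAlong_of_local_extension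
    (P := fun p g => AnalyticAt ℂ g p ∧ iteratedDeriv n g =ᶠ[𝓝 p] h) (fun _ _ h => h.1)
    (fun t => ?_) ⟨hg, hgh⟩
  obtain ⟨r, hr, hb⟩ := Metric.isOpen_iff.1 hU _ (hγ t)
  refine ⟨Metric.ball (γ t) r, Metric.isOpen_ball, Metric.mem_ball_self hr, fun p hp g hg => ?_⟩
  obtain ⟨G, h1, h2, h3⟩ := exists_extension_iteratedDeriv_eq n hp (hh.mono hb) hg.1 hg.2
  exact ⟨G, h2, fun q hq => ⟨h1.analyticAt (Metric.isOpen_ball.mem_nhds hq),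
    h3.eventuallyEq_of_mem (Metric.isOpen_ball.mem_nhds hq)⟩⟩

/-! ### Directional derivatives and permanence of the differential equation -/

/-- The derivative of `g : ℂ × ℂ → ℂ` in the direction `w`, as an operator on functions. -/
def dirDeriv (w : ℂ × ℂ) (g : ℂ × ℂ → ℂ) (v : ℂ × ℂ) : ℂ := fderiv ℂ g v w

lemma analyticAt_dirDeriv (w : ℂ × ℂ) {g : ℂ × ℂ → ℂ} {p : ℂ × ℂ} (hg : AnalyticAt ℂ g p) :
    AnalyticAt ℂ (dirDeriv w g) p :=
  AnalyticAt.comp ((ContinuousLinearMap.apply ℂ ℂ w).analyticAt _) hg.fderiv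

lemma analyticAt_iterate_dirDeriv (w : ℂ × ℂ) (n : ℕ) {g : ℂ × ℂ → ℂ} {p : ℂ × ℂ}
    (hg : AnalyticAt ℂ g p) : AnalyticAt ℂ ((dirDeriv w)^[n] g) p := by
  induction n generalizing g with
  | zero => exact hg
  | succ n ih => exact ih (analyticAt_dirDeriv w hg)

lemma dirDeriv_congr (w : ℂ × ℂ) {g g' : ℂ × ℂ → ℂ} {p : ℂ × ℂ} (h : g =ᶠ[𝓝 p] g') :
    dirDeriv w g =ᶠ[𝓝 p] dirDeriv w g' := by
  filter_upwards [h.fderiv (𝕜 := ℂ)] with v hv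
  rw [dirDeriv, dirDeriv, hv]

lemma iterate_dirDeriv_congr (w : ℂ × ℂ) (n : ℕ) {g g' : ℂ × ℂ → ℂ} {p : ℂ × ℂ}
    (h : g =ᶠ[𝓝 p] g') : (dirDeriv w)^[n] g =ᶠ[𝓝 p] (dirDeriv w)^[n] g' := by
  induction n generalizing g g' with
  | zero => exact h
  | succ n ih => exact ih (dirDeriv_congr w h)

lemma iteratedDeriv_comp_line {g : ℂ × ℂ → ℂ} {w : ℂ × ℂ} {φ : ℂ → ℂ × ℂ}
    (hφ : ∀ t, HasDerivAt φ w t) (n : ℕ) {t : ℂ} (hg : AnalyticAt ℂ g (φ t)) :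
    iteratedDeriv n (fun s => g (φ s)) t = (dirDeriv w)^[n] g (φ t) := by
  induction n generalizing t with
  | zero => simp
  | succ n ih =>
    have hev : iteratedDeriv n (fun s => g (φ s)) =ᶠ[𝓝 t]
        fun s => (dirDeriv w)^[n] g (φ s) := by
      filter_upwards [(hφ t).continuousAt.eventually hg.eventually_analyticAt] with s hs
      exact ih hs
    rw [iteratedDeriv_succ, hev.deriv_eq, Function.iterate_succ_apply', dirDeriv]
    exact ((analyticAt_iterate_dirDeriv w n hg).differentiableAt.hasFDerivAt.comp_hasDerivAt t
      (hφ t)).deriv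

lemma partialDeriv_eq (n m : ℕ) {g : ℂ × ℂ → ℂ} {z τ : ℂ} (hg : AnalyticAt ℂ g (z, τ)) :
    partialDeriv n m g z τ = (dirDeriv (1, 0))^[n] ((dirDeriv (0, 1))^[m] g) (z, τ) := by
  have h1 (a t : ℂ) : HasDerivAt (fun s : ℂ => (a, s)) (0, 1) t :=
    (hasDerivAt_const t a).prodMk (hasDerivAt_id t)
  have h2 (t : ℂ) : HasDerivAt (fun s : ℂ => (s, τ)) (1, 0) t :=
    (hasDerivAt_id t).prodMk (hasDerivAt_const t τ)
  have hev : (fun w => iteratedDeriv m (fun s => g (w, s)) τ) =ᶠ[𝓝 z]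
      fun w => (dirDeriv (0, 1))^[m] g (w, τ) := by
    filter_upwards [(h2 z).continuousAt.eventually hg.eventually_analyticAt] with w hw
    exact iteratedDeriv_comp_line (h1 w) m hw
  rw [partialDeriv, hev.iteratedDeriv_eq n]
  exact iteratedDeriv_comp_line h2 n (analyticAt_iterate_dirDeriv _ m hg)

/-- The difference of the two sides of the differential equation, as an operator on functions.
The Eisenstein series is extended to `ℂ` by `UpperHalfPlane.ofComplex`. -/
def pdeDefect (g : ℂ × ℂ → ℂ) (p : ℂ × ℂ) : ℂ :=
  (dirDeriv (1, 0))^[3] g p * (dirDeriv (1, 0)) ((dirDeriv (0, 1))^[2] g) p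
    - (dirDeriv (1, 0))^[2] (dirDeriv (0, 1) g) p ^ 2 + 1 / 3 * (dirDeriv (0, 1))^[3] g p
    + 1 / 144 * ModularForm.E₄ (UpperHalfPlane.ofComplex p.2)

lemma pdeDefect_congr {g g' : ℂ × ℂ → ℂ} {p : ℂ × ℂ} (h : g =ᶠ[𝓝 p] g') :
    pdeDefect g =ᶠ[𝓝 p] pdeDefect g' := by
  filter_upwards [iterate_dirDeriv_congr (1, 0) 3 h,
    dirDeriv_congr (1, 0) (iterate_dirDeriv_congr (0, 1) 2 h),
    iterate_dirDeriv_congr (1, 0) 2 (dirDeriv_congr (0, 1) h),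
    iterate_dirDeriv_congr (0, 1) 3 h] with v h1 h2 h3 h4
  rw [pdeDefect, pdeDefect, h1, h2, h3, h4]

lemma analyticAt_pdeDefect {g : ℂ × ℂ → ℂ} {p : ℂ × ℂ} (hg : AnalyticAt ℂ g p)
    (hp : 0 < p.2.im) : AnalyticAt ℂ (pdeDefect g) p := by
  have hE : AnalyticAt ℂ (fun p : ℂ × ℂ => ModularForm.E₄ (UpperHalfPlane.ofComplex p.2)) p := by
    have h1 : AnalyticAt ℂ (ModularForm.E₄ ∘ UpperHalfPlane.ofComplex) p.2 :=
      (UpperHalfPlane.mdifferentiable_iff.1 ModularForm.E₄.holo').analyticAt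
        (UpperHalfPlane.isOpen_upperHalfPlaneSet.mem_nhds hp)
    exact AnalyticAt.comp (g := ModularForm.E₄ ∘ UpperHalfPlane.ofComplex) h1 analyticAt_snd
  have h1 := analyticAt_iterate_dirDeriv (1, 0) 3 hg
  have h2 := analyticAt_dirDeriv (1, 0) (analyticAt_iterate_dirDeriv (0, 1) 2 hg)
  have h3 := analyticAt_iterate_dirDeriv (1, 0) 2 (analyticAt_dirDeriv (0, 1) hg)
  have h4 := analyticAt_iterate_dirDeriv (0, 1) 3 hg
  exact (((h1.mul h2).sub (h3.pow 2)).add (analyticAt_const.mul h4)).add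
    (analyticAt_const.mul hE)

/-- Permanence of analytic relations: by the identity theorem, the set of parameters at which the
differential equation holds is open and closed. -/
lemma pdeDefect_eventuallyEq_zero {g : ℂ × ℂ → ℂ} {γ : C(unitInterval, ℂ × ℂ)}
    {F : unitInterval → ℂ × ℂ → ℂ} (hF : IsContinuationAlong g γ F) (hγ : ∀ t, 0 < (γ t).2.im)
    (h0 : pdeDefect g =ᶠ[𝓝 (γ 0)] 0) (t : unitInterval) : pdeDefect (F t) =ᶠ[𝓝 (γ t)] 0 := by
  have key (t : unitInterval) : ∀ᶠ s in 𝓝 t,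
      (pdeDefect (F s) =ᶠ[𝓝 (γ s)] 0 ↔ pdeDefect (F t) =ᶠ[𝓝 (γ t)] 0) := by
    obtain ⟨ε, hε, hb⟩ := Metric.eventually_nhds_iff_ball.1
      (analyticAt_pdeDefect (hF.analyticAt t) (hγ t)).eventually_analyticAt
    have ht : γ t ∈ Metric.ball (γ t) ε := Metric.mem_ball_self hε
    have hz {v w : ℂ × ℂ} (hv : v ∈ Metric.ball (γ t) ε) (hw : w ∈ Metric.ball (γ t) ε)
        (h : pdeDefect (F t) =ᶠ[𝓝 v] 0) : pdeDefect (F t) =ᶠ[𝓝 w] 0 :=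
      (AnalyticOnNhd.eqOn_zero_of_preconnected_of_eventuallyEq_zero hb
        (convex_ball _ _).isPreconnected hv h).eventuallyEq_of_mem
          (Metric.isOpen_ball.mem_nhds hw)
    filter_upwards [hF.coherent t,
      γ.continuous.continuousAt.eventually (Metric.isOpen_ball.eventually_mem ht)] with s hs hsb
    have hc := pdeDefect_congr hs
    exact ⟨fun h => hz hsb ht (hc.symm.trans h), fun h => hc.trans (hz ht hsb h)⟩
  have hcl : IsClopen {t | pdeDefect (F t) =ᶠ[𝓝 (γ t)] 0} := by
    refine ⟨⟨isOpen_iff_eventually.2 fun t ht => ?_⟩, isOpen_iff_eventually.2 fun t ht => ?_⟩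
    · filter_upwards [key t] with s hs using fun h => ht (hs.1 h)
    · filter_upwards [key t] with s hs using hs.2 ht
  have := hcl.eq_univ ⟨0, (pdeDefect_congr hF.start).trans h0⟩
  exact Set.eq_univ_iff_forall.1 this t

/-! ### The trilogarithm series and its analytic continuation -/

section TrilogSum

variable {E : Type*} [NormedAddCommGroup E] [NormedSpace ℂ E]

/-- The functionals `(k + 1) (l + m μ)`, indexed by pairs `(m, k)`. -/
def latticeFunctional (l μ : E →L[ℂ] ℂ) (p : ℕ × ℕ) : E →L[ℂ] ℂ :=
  ((p.2 : ℂ) + 1) • (l + (p.1 : ℂ) • μ)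

/-- The double series `∑_{m ≥ 0} Li₃(exp (l + m μ))`, expanded as an exponential series. -/
def trilogSum (l μ : E →L[ℂ] ℂ) : E → ℂ :=
  expSum (fun p : ℕ × ℕ => 1 / ((p.2 : ℂ) + 1) ^ 3) (latticeFunctional l μ)

lemma latticeFunctional_apply (l μ : E →L[ℂ] ℂ) (p : ℕ × ℕ) (v : E) :
    latticeFunctional l μ p v = (p.2 + 1) * (l v + p.1 * μ v) := by
  simp [latticeFunctional, mul_add]

lemma summable_geometric_mul_geometric {y : ℝ} (h0 : 0 ≤ y) (h1 : y < 1) :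
    Summable fun p : ℕ × ℕ => y ^ p.1 * y ^ p.2 :=
  (summable_geometric_of_lt_one h0 h1).mul_of_nonneg (summable_geometric_of_lt_one h0 h1)
    (fun _ => by positivity) (fun _ => by positivity)

lemma expSummableAt_trilogSum {l μ : E →L[ℂ] ℂ} {v : E} (hl : (l v).re < 0) (hμ : (μ v).re < 0) :
    ExpSummableAt (fun p : ℕ × ℕ => 1 / ((p.2 : ℂ) + 1) ^ 3) (latticeFunctional l μ) v := by
  obtain ⟨ε, hε, hεl, hεμ⟩ : ∃ ε > 0, ε ≤ -(l v).re ∧ ε ≤ -(μ v).re :=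
    ⟨min (-(l v).re) (-(μ v).re), lt_min (by linarith) (by linarith), min_le_left _ _,
      min_le_right _ _⟩
  set R : ℝ := ‖l‖ + ‖μ‖ + 1
  have hR : 0 < R := by positivity
  refine ⟨ε / (2 * R), by positivity, (summable_geometric_mul_geometric (Real.exp_pos _).le
    (Real.exp_lt_one_iff.mpr (show -(ε / 2) < 0 by linarith))).of_nonneg_of_le
      (fun p => by positivity) fun p => ?_⟩
  obtain ⟨m, k⟩ := p
  have hm : (0 : ℝ) ≤ m := m.cast_nonneg
  have hk : (0 : ℝ) ≤ k := k.cast_nonneg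
  have hc : ‖1 / ((k : ℂ) + 1) ^ 3‖ ≤ 1 := by
    rw [norm_div, norm_one, norm_pow, ← Nat.cast_add_one, Complex.norm_natCast]
    exact (div_le_one (by positivity)).2 (one_le_pow₀ (by simp))
  have hnorm : ‖latticeFunctional l μ (m, k)‖ ≤ (k + 1) * (m + 1) * R := by
    rw [latticeFunctional, norm_smul, ← Nat.cast_add_one, Complex.norm_natCast, mul_assoc,
      Nat.cast_add_one]
    gcongr
    refine (norm_add_le _ _).trans ?_
    rw [norm_smul, Complex.norm_natCast]
    nlinarith [norm_nonneg l, norm_nonneg μ, mul_nonneg hm (norm_nonneg l)]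
  have hre : (latticeFunctional l μ (m, k) v).re = (k + 1) * ((l v).re + m * (μ v).re) := by
    rw [latticeFunctional_apply]
    simp
  have h2 : (k + 1) * ((l v).re + m * (μ v).re) ≤ (k + 1) * (-((m + 1) * ε)) := by
    gcongr
    nlinarith
  have h3 : ε / (2 * R) * ‖latticeFunctional l μ (m, k)‖ ≤ (k + 1) * (m + 1) * (ε / 2) := by
    calc _ ≤ ε / (2 * R) * ((k + 1) * (m + 1) * R) := by gcongr
      _ = _ := by field_simp
  rw [← Real.exp_nat_mul, ← Real.exp_nat_mul, ← Real.exp_add]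
  calc _ ≤ 1 * Real.exp ((latticeFunctional l μ (m, k) v).re +
        ε / (2 * R) * ‖latticeFunctional l μ (m, k)‖) := by gcongr
    _ ≤ _ := by
      rw [one_mul, Real.exp_le_exp, hre]
      nlinarith [mul_nonneg hm hk]

lemma trilogSum_eq_tsum_Li {l μ : E →L[ℂ] ℂ} {v : E} (hl : (l v).re < 0) (hμ : (μ v).re < 0) :
    HasSum (fun m : ℕ => Li 3 (exp (μ v) ^ m * exp (l v))) (trilogSum l μ v) := by
  have h := (expSummableAt_trilogSum hl hμ).summable
  refine h.hasSum.prod_fiberwise fun m => ?_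
  convert! (h.prod_factor m).hasSum using 1
  rw [Li]
  refine tsum_congr fun k => ?_
  rw [latticeFunctional_apply, ← Complex.exp_nat_mul, ← Complex.exp_add, ← Complex.exp_nat_mul]
  push_cast
  ring_nf

lemma trilogSum_eq_add {l μ : E →L[ℂ] ℂ} {v : E} (hl : (l v).re < 0) (hμ : (μ v).re < 0) :
    trilogSum l μ v = Li 3 (exp (l v)) + trilogSum (l + μ) μ v := by
  have h1 := trilogSum_eq_tsum_Li hl hμ
  have h2 := trilogSum_eq_tsum_Li (l := l + μ) (v := v) (by simpa using by linarith) hμ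
  rw [← h1.tsum_eq, h1.summable.tsum_eq_zero_add, ← h2.tsum_eq]
  congr 1
  · simp
  · refine tsum_congr fun m => ?_
    rw [add_apply, Complex.exp_add]
    ring_nf

lemma analyticAt_trilogSum {l μ : E →L[ℂ] ℂ} {v : E} (hl : (l v).re < 0) (hμ : (μ v).re < 0) :
    AnalyticAt ℂ (trilogSum l μ) v :=
  analyticAt_expSum (expSummableAt_trilogSum hl hμ)

end TrilogSum

lemma expSummableAt_Li {u : ℂ} (hu : u.re < 0) :
    ExpSummableAt (fun k : ℕ => 1 / ((k : ℂ) + 1) ^ 3)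
      (fun k : ℕ => ((k : ℂ) + 1) • ContinuousLinearMap.id ℂ ℂ) u := by
  obtain ⟨r, hr, h⟩ := expSummableAt_trilogSum (l := ContinuousLinearMap.id ℂ ℂ)
    (μ := ContinuousLinearMap.id ℂ ℂ) hu hu
  refine ⟨r, hr, ?_⟩
  have := h.comp_injective (i := fun k : ℕ => ((0 : ℕ), k)) fun a b hab => by simpa using hab
  simpa [Function.comp_def, latticeFunctional] using this

lemma Li_exp_eq_expSum (u : ℂ) :
    Li 3 (exp u) = expSum (fun k : ℕ => 1 / ((k : ℂ) + 1) ^ 3)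
      (fun k : ℕ => ((k : ℂ) + 1) • ContinuousLinearMap.id ℂ ℂ) u := by
  rw [Li, expSum]
  refine tsum_congr fun k => ?_
  rw [← Complex.exp_nat_mul]
  simp [div_eq_inv_mul]

lemma iteratedDeriv_expSum (n : ℕ) {ι : Type*} {c : ι → ℂ} {L : ι → ℂ →L[ℂ] ℂ} {u : ℂ}
    (h : ExpSummableAt c L u) :
    iteratedDeriv n (expSum c L) =ᶠ[𝓝 u] expSum (fun i => c i * (L i 1) ^ n) L := by
  induction n generalizing c with
  | zero => simp
  | succ n ih =>
    have hd : deriv (expSum c L) =ᶠ[𝓝 u] expSum (fun i => c i * L i 1) L := by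
      filter_upwards [h.eventually] with w hw
      rw [← fderiv_expSum_apply hw, fderiv_apply_one_eq_deriv]
    rw [iteratedDeriv_succ']
    refine (hd.iteratedDeriv n).trans ((ih (h.mul_apply 1)).trans (.of_eq ?_))
    congr 1
    ext i
    ring

/-- `Li₃(exp u)` continues along all paths avoiding `2πiℤ`, as its third derivative
`exp u / (1 - exp u)` is single-valued there. -/
lemma continuesAlong_Li_exp {γ : C(unitInterval, ℂ)} (h0 : (γ 0).re < 0)
    (hγ : ∀ t, exp (γ t) ≠ 1) : ContinuesAlong (fun u => Li 3 (exp u)) γ := by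
  have hs := expSummableAt_Li h0
  have hfun : (fun u => Li 3 (exp u)) = expSum (fun k : ℕ => 1 / ((k : ℂ) + 1) ^ 3)
      (fun k : ℕ => ((k : ℂ) + 1) • ContinuousLinearMap.id ℂ ℂ) := funext Li_exp_eq_expSum
  have hU : IsOpen {u : ℂ | exp u ≠ 1} := isOpen_ne_fun Complex.continuous_exp continuous_const
  refine continuesAlong_of_iteratedDeriv_eq 3 hU (h := fun u => exp u / (1 - exp u))
    (fun u hu => ?_) hγ (hfun ▸ analyticAt_expSum hs) ?_
  · have hu' : 1 - exp u ≠ 0 := sub_ne_zero.2 (Ne.symm hu)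
    have : DifferentiableAt ℂ (fun u => exp u / (1 - exp u)) u := by fun_prop (disch := exact hu')
    exact this.differentiableWithinAt
  · rw [hfun]
    refine (iteratedDeriv_expSum 3 hs).trans ?_
    filter_upwards [Complex.continuous_re.continuousAt.eventually_lt continuousAt_const h0]
      with u hu
    have hn : ‖exp u‖ < 1 := by
      rw [Complex.norm_exp]; exact Real.exp_lt_one_iff.mpr hu
    have hg := (hasSum_geometric_of_norm_lt_one hn).mul_left (exp u)
    rw [expSum, div_eq_mul_inv, ← hg.tsum_eq]
    refine tsum_congr fun k => ?_
    have hk : (k : ℂ) + 1 ≠ 0 := Nat.cast_add_one_ne_zero k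
    rw [← Complex.exp_nat_mul, ← Complex.exp_add]
    simp [hk]
    ring_nf

section TrilogSum

variable {E : Type*} [NormedAddCommGroup E] [NormedSpace ℂ E]

/-- On a path, all but finitely many terms of the series `∑ Li₃(exp (l + m μ))` have their
argument in the unit disc; the sum of these is analytic, and the others continue one by one. -/
lemma continuesAlong_trilogSum {l μ : E →L[ℂ] ℂ} {γ : C(unitInterval, E)}
    (h0 : (l (γ 0)).re < 0) (hμ : ∀ t, (μ (γ t)).re < 0)
    (hne : ∀ t, ∀ m : ℕ, exp (l (γ t) + m * μ (γ t)) ≠ 1) :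
    ContinuesAlong (trilogSum l μ) γ := by
  have hN : ∃ N : ℕ, ∀ t, (l (γ t) + N * μ (γ t)).re < 0 := by
    have hc1 : Continuous fun t => (l (γ t)).re := by fun_prop
    have hc2 : Continuous fun t => (μ (γ t)).re := by fun_prop
    obtain ⟨a, -, ha⟩ := isCompact_univ.exists_isMaxOn Set.univ_nonempty hc1.continuousOn
    obtain ⟨b, -, hb⟩ := isCompact_univ.exists_isMaxOn Set.univ_nonempty hc2.continuousOn
    obtain ⟨N, hN⟩ := exists_nat_gt ((l (γ a)).re / -(μ (γ b)).re)
    refine ⟨N, fun t => ?_⟩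
    have h1 : (l (γ t)).re ≤ (l (γ a)).re := ha (Set.mem_univ t)
    have h2 : (μ (γ t)).re ≤ (μ (γ b)).re := hb (Set.mem_univ t)
    have h3 := hμ b
    rw [div_lt_iff₀ (by linarith)] at hN
    have h4 : (N : ℝ) * (μ (γ t)).re ≤ N * (μ (γ b)).re := by gcongr
    simp only [Complex.add_re, Complex.mul_re, Complex.natCast_re, Complex.natCast_im, zero_mul,
      sub_zero]
    linarith
  obtain ⟨N, hN⟩ := hN
  induction N generalizing l with
  | zero =>
    exact continuesAlong_of_analyticAt fun t =>
      analyticAt_trilogSum (by simpa using hN t) (hμ t)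
  | succ N ih =>
    have h1 : ContinuesAlong (fun v => Li 3 (exp (l v))) γ :=
      ContinuesAlong.comp_clm (g := fun u => Li 3 (exp u)) l
        (continuesAlong_Li_exp h0 fun t => by simpa using hne t 0)
    have h2 : ContinuesAlong (trilogSum (l + μ) μ) γ := by
      refine ih ?_ (fun t m => ?_) (fun t => ?_)
      · simpa using by linarith [hμ 0]
      · have := hne t (m + 1)
        push_cast at this
        rw [add_apply]
        convert! this using 2
        ring
      · have := hN t
        push_cast at this
        rw [add_apply]
        convert! this using 2
        ring
    refine (h1.add h2).congr ?_
    have c1 : Continuous fun v => (l v).re := by fun_prop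
    have c2 : Continuous fun v => (μ v).re := by fun_prop
    filter_upwards [c1.continuousAt.eventually_lt continuousAt_const h0,
      c2.continuousAt.eventually_lt continuousAt_const (hμ 0)] with v hv1 hv2
    exact (trilogSum_eq_add hv1 hv2).symm

end TrilogSum

lemma iterate_dirDeriv_expSum (w : ℂ × ℂ) (n : ℕ) {ι : Type*} {c : ι → ℂ}
    {L : ι → ℂ × ℂ →L[ℂ] ℂ} {v : ℂ × ℂ} (h : ExpSummableAt c L v) :
    ExpSummableAt (fun i => c i * (L i w) ^ n) L v ∧
      (dirDeriv w)^[n] (expSum c L) =ᶠ[𝓝 v] expSum (fun i => c i * (L i w) ^ n) L := by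
  induction n generalizing c with
  | zero => simpa [Filter.EventuallyEq.rfl] using h
  | succ n ih =>
    have hd : dirDeriv w (expSum c L) =ᶠ[𝓝 v] expSum (fun i => c i * L i w) L := by
      filter_upwards [h.eventually] with u hu using fderiv_expSum_apply hu w
    obtain ⟨h1, h2⟩ := ih (h.mul_apply w)
    have e : (fun i => c i * L i w * (L i w) ^ n) = fun i => c i * (L i w) ^ (n + 1) := by
      ext i; ring
    rw [e] at h1 h2
    exact ⟨h1, (iterate_dirDeriv_congr w n hd).trans h2⟩

/-- The third partial derivatives of the trilogarithm series: the denominators `(k + 1)³`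
cancel. -/
lemma hasSum_iterate_dirDeriv_trilogSum {l μ : ℂ × ℂ →L[ℂ] ℂ} {v : ℂ × ℂ} (hl : (l v).re < 0)
    (hμ : (μ v).re < 0) (w w' : ℂ × ℂ) {n m : ℕ} (hnm : n + m = 3) :
    HasSum (fun p : ℕ × ℕ => (l w + p.1 * μ w) ^ n * (l w' + p.1 * μ w') ^ m *
      exp ((p.2 + 1) * (l v + p.1 * μ v)))
      ((dirDeriv w)^[n] ((dirDeriv w')^[m] (trilogSum l μ)) v) := by
  obtain ⟨h1, h2⟩ := iterate_dirDeriv_expSum w' m (expSummableAt_trilogSum hl hμ)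
  obtain ⟨h3, h4⟩ := iterate_dirDeriv_expSum w n h1
  rw [trilogSum, ((iterate_dirDeriv_congr w n h2).trans h4).eq_of_nhds]
  convert! h3.summable.hasSum using 1
  ext p
  have hk : (p.2 : ℂ) + 1 ≠ 0 := Nat.cast_add_one_ne_zero p.2
  simp only [latticeFunctional_apply, mul_pow]
  have : ((p.2 : ℂ) + 1) ^ 3 = (p.2 + 1) ^ n * (p.2 + 1) ^ m := by rw [← pow_add, hnm]
  rw [this]
  field_simp

/-! ### The quadratic identity between Laurent series -/

/-- The power sums `∑ mʳ xᵐ`, `r ≤ 3`, in closed form. -/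
def eulerian : Fin 4 → ℂ → ℂ
  | 0, x => 1 / (1 - x)
  | 1, x => x / (1 - x) ^ 2
  | 2, x => x * (1 + x) / (1 - x) ^ 3
  | 3, x => x * (1 + 4 * x + x ^ 2) / (1 - x) ^ 4

lemma hasSum_eulerian (r : Fin 4) {x : ℂ} (hx : ‖x‖ < 1) :
    HasSum (fun m : ℕ => (m : ℂ) ^ (r : ℕ) * x ^ m) (eulerian r x) := by
  have hx1 : 1 - x ≠ 0 := by
    rintro h
    rw [← sub_eq_zero.1 h] at hx
    simp at hx
  have h0 := hasSum_choose_mul_geometric_of_norm_lt_one 0 hx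
  have h1 := hasSum_choose_mul_geometric_of_norm_lt_one 1 hx
  have h2 := hasSum_choose_mul_geometric_of_norm_lt_one 2 hx
  have h3 := hasSum_choose_mul_geometric_of_norm_lt_one 3 hx
  have c2 (m : ℕ) : ((m + 2).choose 2 : ℂ) = (m + 2) * (m + 1) / 2 := by
    rw [Nat.cast_choose_two]; push_cast; ring
  have c3 (m : ℕ) : ((m + 3).choose 3 : ℂ) = (m + 3) * (m + 2) * (m + 1) / 6 := by
    rw [add_comm m 3, Nat.cast_add_choose, add_comm 3 m]
    have : (m.factorial : ℂ) ≠ 0 := by exact_mod_cast m.factorial_ne_zero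
    simp only [Nat.factorial_succ, Nat.factorial_zero]
    push_cast
    field_simp
    ring
  simp only [c2, c3, Nat.choose_zero_right, Nat.choose_one_right, Nat.cast_one] at h0 h1 h2 h3
  push_cast at h1
  fin_cases r
  · simpa [eulerian] using h0
  · convert! h1.sub h0 using 1
    · ext m; simp; ring
    · simp only [eulerian]; field_simp; ring
  · convert! ((h2.mul_left 2).sub (h1.mul_left 3)).add h0 using 1
    · ext m; simp; ring
    · simp only [eulerian]; field_simp; ring
  · convert! (((h3.mul_left 6).sub (h2.mul_left 12)).add (h1.mul_left 7)).sub h0 using 1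
    · ext m; simp; ring
    · simp only [eulerian]; field_simp; ring

lemma hasSum_eulerian_succ (r : Fin 4) (hr : r ≠ 0) {x : ℂ} (hx : ‖x‖ < 1) :
    HasSum (fun m : ℕ => ((m : ℂ) + 1) ^ (r : ℕ) * x ^ (m + 1)) (eulerian r x) := by
  have := (hasSum_nat_add_iff' 1).2 (hasSum_eulerian r hx)
  simpa [Fin.val_ne_zero_iff.2 hr] using this

lemma eulerian_inv (r : Fin 4) (hr : r ≠ 0) {x : ℂ} (hx : x ≠ 0) :
    eulerian r x⁻¹ = (-1) ^ ((r : ℕ) + 1) * eulerian r x := by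
  by_cases h1 : x = 1
  · subst h1
    fin_cases r <;> simp [eulerian] at hr ⊢
  have h : x - 1 ≠ 0 := sub_ne_zero.2 h1
  have h' : 1 - x ≠ 0 := sub_ne_zero.2 (Ne.symm h1)
  have e : 1 - x⁻¹ = -(1 - x) * x⁻¹ := by field_simp; ring
  fin_cases r
  · exact absurd rfl hr
  all_goals
    simp only [eulerian]
    rw [e]
    field_simp
    ring

/-- At `x = 1` the division by zero makes the closed forms vanish, so that `eulerian 2` and
`eulerian 3` need no exception at the exponent `0`. -/
lemma eulerian_one (r : Fin 4) : eulerian r 1 = 0 := by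
  fin_cases r <;> simp [eulerian]

/-- The partial fraction identity behind the quadratic relation. -/
lemma eulerian_addition {x y : ℂ} (hx : x ≠ 1) (hy : y ≠ 1) (hxy : x * y ≠ 1) :
    (eulerian 0 x * eulerian 2 y + eulerian 0 y * eulerian 2 x) / 2 - eulerian 1 x * eulerian 1 y
      = (eulerian 2 x + eulerian 2 y) / (2 * (1 - x * y)) := by
  have h1 : 1 - x ≠ 0 := sub_ne_zero.2 (Ne.symm hx)
  have h2 : 1 - y ≠ 0 := sub_ne_zero.2 (Ne.symm hy)
  have h3 : 1 - x * y ≠ 0 := sub_ne_zero.2 (Ne.symm hxy)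
  simp only [eulerian]
  field_simp
  ring

/-- The degenerate case `x y = 1` of `eulerian_addition`. -/
lemma eulerian_addition_inv {x : ℂ} (h0 : x ≠ 0) (h1 : x ≠ 1) :
    (eulerian 0 x * eulerian 2 x⁻¹ + eulerian 0 x⁻¹ * eulerian 2 x) / 2
      - eulerian 1 x * eulerian 1 x⁻¹ = -(1 / 2) * eulerian 3 x := by
  have h : 1 - x ≠ 0 := sub_ne_zero.2 (Ne.symm h1)
  have e : eulerian 0 x⁻¹ = 1 - eulerian 0 x := by
    have e : 1 - x⁻¹ = -(1 - x) * x⁻¹ := by field_simp; ring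
    simp only [eulerian]
    rw [e]
    field_simp
    ring
  have e₁ : eulerian 1 x⁻¹ = eulerian 1 x := by
    rw [eulerian_inv 1 (by decide) h0]; norm_num
  have e₂ : eulerian 2 x⁻¹ = -eulerian 2 x := by
    rw [eulerian_inv 2 (by decide) h0]; norm_num
  rw [e, e₁, e₂]
  simp only [eulerian]
  field_simp
  ring

/-- The contribution of the two pairs `(0, j)` and `(j, 0)`. The constants `1/2` and `-1/12` are
the constant terms of the Laurent series. -/
lemma eulerian_boundary {x : ℂ} (h1 : x ≠ 1) :
    2 * ((1 / 2 * eulerian 2 x) / 2 - (-1 / 12) * eulerian 1 x - eulerian 2 x / (2 * (1 - x)))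
      = -(1 / 3) * eulerian 3 x := by
  have h : 1 - x ≠ 0 := sub_ne_zero.2 (Ne.symm h1)
  simp only [eulerian]
  field_simp
  ring

lemma zpow_ne_one_of_norm_lt_one {q : ℂ} (hq : ‖q‖ < 1) {j : ℤ} (hj : j ≠ 0) :
    q ^ j ≠ 1 := by
  intro h
  have := congrArg norm h
  rw [norm_zpow, norm_one] at this
  exact hj ((zpow_eq_one_iff_right₀ (norm_nonneg q) hq.ne).1 this)

/-- The `j`-th Laurent coefficient of the third derivative `f^{(3-r, r)}`; the coefficient `c` with
`j = 0` is a parameter. -/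
def laurentCoeff (q : ℂ) (r : Fin 4) (c : ℂ) (j : ℤ) : ℂ := if j = 0 then c else eulerian r (q ^ j)

/-- The geometric-type sums over `m` turn the two halves of a third derivative into the positive and
the negative part of a Laurent series. -/
lemma hasSum_laurent {q ζ : ℂ} (hq0 : q ≠ 0) (hq : ‖q‖ < 1) (r : Fin 4) (c : ℂ)
    {s₁ s₂ : ℂ}
    (h₁ : HasSum (fun p : ℕ × ℕ => (p.1 : ℂ) ^ (r : ℕ) * (ζ * q ^ p.1) ^ (p.2 + 1)) s₁)
    (h₂ : HasSum (fun p : ℕ × ℕ =>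
      ((p.1 : ℂ) + 1) ^ (r : ℕ) * (q ^ (p.1 + 1) * ζ⁻¹) ^ (p.2 + 1)) s₂) :
    HasSum (fun j : ℤ => laurentCoeff q r c j * ζ ^ j) (c + s₁ + (-1) ^ ((r : ℕ) + 1) * s₂) := by
  have hqk (k : ℕ) : ‖q ^ (k + 1)‖ < 1 := by
    rw [norm_pow]; exact pow_lt_one₀ (norm_nonneg _) hq k.succ_ne_zero
  refine HasSum.of_nat_of_neg_add_one ?_ ?_
  · rw [← hasSum_nat_add_iff' 1]
    have h := ((Equiv.prodComm ℕ ℕ).hasSum_iff.2 h₁).prod_fiberwise (g := fun k =>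
      laurentCoeff q r c ((k + 1 : ℕ) : ℤ) * ζ ^ ((k + 1 : ℕ) : ℤ)) fun k => ?_
    · simpa [laurentCoeff] using h
    · rw [laurentCoeff, if_neg (by positivity), zpow_natCast, zpow_natCast]
      convert! (hasSum_eulerian r (hqk k)).mul_right (ζ ^ (k + 1)) using 1
      ext m
      simp [mul_pow, ← pow_mul, mul_comm]
      ring
  · refine ((Equiv.prodComm ℕ ℕ).hasSum_iff.2 h₂).mul_left ((-1) ^ ((r : ℕ) + 1))
      |>.prod_fiberwise fun k => ?_
    rw [laurentCoeff, if_neg (by omega), show (-((k : ℤ) + 1)) = -((k + 1 : ℕ) : ℤ) by simp,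
      zpow_neg, zpow_neg, zpow_natCast, zpow_natCast]
    by_cases hr : r = 0
    · subst hr
      have hx1 : 1 - q ^ (k + 1) ≠ 0 := by
        refine sub_ne_zero.2 fun h => ?_
        have := hqk k
        simp [← h] at this
      have hx0 : q ^ (k + 1) ≠ 0 := pow_ne_zero _ hq0
      convert! ((hasSum_geometric_of_norm_lt_one (hqk k)).mul_left
        (-(q ^ (k + 1)) * (ζ ^ (k + 1))⁻¹)) using 1
      · ext m
        simp [mul_pow, ← pow_mul]
        ring
      · have e : 1 - (q ^ (k + 1))⁻¹ = -(1 - q ^ (k + 1)) * (q ^ (k + 1))⁻¹ := by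
          field_simp; ring
        rw [eulerian, e]
        field_simp
    · rw [eulerian_inv r hr (pow_ne_zero _ hq0)]
      convert! ((hasSum_eulerian_succ r hr (hqk k)).mul_left ((-1) ^ ((r : ℕ) + 1))).mul_right
        (ζ ^ (k + 1))⁻¹ using 1
      ext m
      simp [mul_pow, ← pow_mul]
      ring

/-- A sequence `eulerian r (qʲ)` is summable over `ℤ` if it is so after multiplication by `ζʲ`,
`|ζ| < 1`: this factor only helps for `j ≥ 0`, but the sequence is even or odd. -/
lemma summable_eulerian_zpow {q ζ : ℂ} (hq0 : q ≠ 0) (hζ0 : ζ ≠ 0) (hζ : ‖ζ‖ < 1) {r : Fin 4}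
    (hr : r ≠ 0) {c : ℂ} (h : Summable fun j : ℤ => laurentCoeff q r c j * ζ ^ j) :
    Summable fun j : ℤ => eulerian r (q ^ j) := by
  have h1 : Summable fun k : ℕ => eulerian r (q ^ (-((k : ℤ) + 1))) := by
    refine Summable.of_norm_bounded (h.norm.comp_injective
      (i := fun k : ℕ => -((k : ℤ) + 1)) fun a b hab => by simpa using hab) fun k => ?_
    simp only [Function.comp_apply]
    rw [laurentCoeff, if_neg (by omega), norm_mul, norm_zpow]
    refine le_mul_of_one_le_right (norm_nonneg _) ?_
    rw [zpow_neg]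
    refine (one_le_inv₀ (zpow_pos (norm_pos_iff.2 hζ0) _)).2 ?_
    exact zpow_le_one₀ (norm_pos_iff.2 hζ0) hζ.le (by positivity)
  refine Summable.of_nat_of_neg_add_one ?_ h1
  rw [← summable_nat_add_iff 1]
  refine (h1.mul_left ((-1) ^ ((r : ℕ) + 1))).congr fun k => ?_
  rw [zpow_neg, eulerian_inv r hr (zpow_ne_zero _ hq0), ← mul_assoc, ← mul_pow]
  simp

/-- The Laurent coefficients of `f^{(3,0)} f^{(1,2)} - (f^{(2,1)})²`, symmetrized. -/
def quadCoeff (q : ℂ) (j k : ℤ) : ℂ :=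
  (laurentCoeff q 0 (1 / 2) j * laurentCoeff q 2 0 k
    + laurentCoeff q 0 (1 / 2) k * laurentCoeff q 2 0 j) / 2
    - laurentCoeff q 1 (-1 / 12) j * laurentCoeff q 1 (-1 / 12) k

/-- For `m ≠ 0` the coefficient of `ζᵐ` is computed by `eulerian_addition`; the main terms add up
to zero because `eulerian 2` is odd, and the terms with `j = 0` and `j = m` remain. -/
lemma hasSum_quadCoeff_of_ne_zero {q : ℂ} (hq0 : q ≠ 0) (hq : ‖q‖ < 1)
    (hs : Summable fun j : ℤ => eulerian 2 (q ^ j)) {m : ℤ} (hm : m ≠ 0) :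
    HasSum (fun j => quadCoeff q j (m - j)) (-(1 / 3) * eulerian 3 (q ^ m)) := by
  have h0 : HasSum (fun j : ℤ => eulerian 2 (q ^ j)) 0 := by
    have h := hs.hasSum
    have h' := (Equiv.neg ℤ).hasSum_iff.2 h
    have e : ((fun j : ℤ => eulerian 2 (q ^ j)) ∘ Equiv.neg ℤ)
        = fun j : ℤ => -eulerian 2 (q ^ j) := by
      ext j
      simp only [Function.comp_apply, Equiv.neg_apply, zpow_neg]
      rw [eulerian_inv 2 (by decide) (zpow_ne_zero _ hq0)]
      norm_num
    rw [e] at h'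
    have := h.neg.unique h'
    rw [show (∑' j : ℤ, eulerian 2 (q ^ j)) = 0 by linear_combination -(1 / 2 : ℂ) * this] at h
    exact h
  have h1 : HasSum (fun j : ℤ => eulerian 2 (q ^ (m - j))) 0 :=
    (Equiv.subLeft m).hasSum_iff.2 h0
  have hM := zpow_ne_one_of_norm_lt_one hq hm
  set M := q ^ m with hMdef
  have hM' : 1 - M ≠ 0 := sub_ne_zero.2 (Ne.symm hM)
  set κ : ℂ := (1 / 2 * eulerian 2 M) / 2 - (-1 / 12) * eulerian 1 M - eulerian 2 M / (2 * (1 - M))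
    with hκ
  have hsum := (((h0.add h1).mul_left (1 / (2 * (1 - M)))).add (hasSum_ite_eq (0 : ℤ) κ)).add
    (hasSum_ite_eq m κ)
  convert! hsum using 1
  · ext j
    by_cases hj : j = 0
    · subst hj
      simp [quadCoeff, laurentCoeff, hm, hm.symm, eulerian_one, ← hMdef]
      rw [hκ]
      field_simp
      ring
    by_cases hjm : j = m
    · subst hjm
      simp [quadCoeff, laurentCoeff, hm, eulerian_one, ← hMdef]
      rw [hκ]
      field_simp
      ring
    have hjm' : m - j ≠ 0 := sub_ne_zero.2 (Ne.symm hjm)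
    have hprod : q ^ j * q ^ (m - j) = M := by
      rw [← zpow_add₀ hq0, add_sub_cancel]
    have := eulerian_addition (zpow_ne_one_of_norm_lt_one hq hj)
      (zpow_ne_one_of_norm_lt_one hq hjm') (hprod ▸ hM)
    rw [hprod] at this
    simp only [quadCoeff, laurentCoeff, hj, hjm, hjm', if_false, add_zero]
    rw [this]
    ring
  · rw [← eulerian_boundary hM, ← hκ]
    ring

/-- The constant coefficient, where `eulerian_addition_inv` replaces `eulerian_addition`. -/
lemma hasSum_quadCoeff_zero {q : ℂ} (hq0 : q ≠ 0) (hq : ‖q‖ < 1) {d : ℂ}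
    (hd : HasSum (fun k : ℕ => eulerian 3 (q ^ (k + 1))) d) :
    HasSum (fun j => quadCoeff q j (0 - j)) (-1 / 144 - d) := by
  have h3 : HasSum (fun j : ℤ => eulerian 3 (q ^ j)) (d + d) := by
    refine HasSum.of_nat_of_neg_add_one ?_ ?_
    · rw [← hasSum_nat_add_iff' 1]
      have e (k : ℕ) : q ^ ((k : ℤ) + 1) = q ^ (k + 1) := by norm_cast
      simpa [eulerian_one, e] using hd
    · convert! hd using 1
      ext k
      rw [zpow_neg, eulerian_inv 3 (by decide) (zpow_ne_zero _ hq0)]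
      norm_num
      norm_cast
  convert! (h3.mul_left (-(1 / 2))).add (hasSum_ite_eq (0 : ℤ) (-1 / 144 : ℂ)) using 1
  · ext j
    by_cases hj : j = 0
    · subst hj
      simp [quadCoeff, laurentCoeff, eulerian_one]
      norm_num
    · have := eulerian_addition_inv (zpow_ne_zero j hq0) (zpow_ne_one_of_norm_lt_one hq hj)
      rw [← zpow_neg] at this
      simp only [quadCoeff, laurentCoeff, zero_sub, neg_eq_zero, hj, if_false, add_zero]
      exact this
  · ring

/-- The differential equation as an identity of Laurent series in `ζ`, for `|q| < |ζ| < 1`. -/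
lemma laurent_identity {q ζ a b c d e : ℂ} (hq0 : q ≠ 0) (hq : ‖q‖ < 1) (hζ0 : ζ ≠ 0)
    (hζ : ‖ζ‖ < 1)
    (ha : HasSum (fun j : ℤ => laurentCoeff q 0 (1 / 2) j * ζ ^ j) a)
    (hb : HasSum (fun j : ℤ => laurentCoeff q 1 (-1 / 12) j * ζ ^ j) b)
    (hc : HasSum (fun j : ℤ => laurentCoeff q 2 0 j * ζ ^ j) c)
    (hd : HasSum (fun j : ℤ => laurentCoeff q 3 (-2 * e) j * ζ ^ j) d)
    (he : HasSum (fun k : ℕ => eulerian 3 (q ^ (k + 1))) e) :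
    a * c - b ^ 2 + 1 / 3 * d = -(1 / 144) * (1 + 240 * e) := by
  set u : Fin 4 → ℂ → ℤ → ℂ := fun r c j => laurentCoeff q r c j * ζ ^ j with hu
  have hac : HasSum (fun p : ℤ × ℤ => u 0 (1 / 2) p.1 * u 2 0 p.2) (a * c) :=
    HasSum.mul ha hc (summable_mul_of_summable_norm ha.summable.norm hc.summable.norm)
  have hbb : HasSum (fun p : ℤ × ℤ => u 1 (-1 / 12) p.1 * u 1 (-1 / 12) p.2) (b * b) :=
    HasSum.mul hb hb (summable_mul_of_summable_norm hb.summable.norm hb.summable.norm)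
  -- the pairs `(j, k)` are reindexed by `(j + k, j)`
  let φ : ℤ × ℤ ≃ ℤ × ℤ :=
    { toFun := fun p => (p.2, p.1 - p.2)
      invFun := fun p => (p.1 + p.2, p.1)
      left_inv := fun p => by simp
      right_inv := fun p => by simp }
  have h1 := φ.hasSum_iff.2 hac
  have h2 := (φ.trans (Equiv.prodComm ℤ ℤ)).hasSum_iff.2 hac
  have h3 := φ.hasSum_iff.2 hbb
  have h4 := ((h1.add h2).mul_left (1 / 2)).sub h3
  have h5 : HasSum (fun p : ℤ × ℤ => quadCoeff q p.2 (p.1 - p.2) * ζ ^ p.1) (a * c - b ^ 2) := by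
    convert! h4 using 1
    · ext p
      have : ζ ^ p.1 = ζ ^ p.2 * ζ ^ (p.1 - p.2) := by rw [← zpow_add₀ hζ0, add_sub_cancel]
      simp only [Function.comp_apply, φ, Equiv.coe_fn_mk, Equiv.trans_apply,
        Equiv.prodComm_apply, Prod.swap, quadCoeff, hu]
      rw [this]
      ring
    · ring
  have h6 := h5.prod_fiberwise (g := fun m : ℤ =>
      (if m = 0 then -1 / 144 - e else -(1 / 3) * eulerian 3 (q ^ m)) * ζ ^ m) fun m => by
    refine HasSum.mul_right (ζ ^ m) (f := fun j => quadCoeff q j (m - j)) ?_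
    split_ifs with hm
    · rw [hm]
      exact hasSum_quadCoeff_zero hq0 hq he
    · have hs : Summable fun j : ℤ => eulerian 2 (q ^ j) :=
        summable_eulerian_zpow hq0 hζ0 hζ (by decide) hc.summable
      exact hasSum_quadCoeff_of_ne_zero hq0 hq hs hm
  refine (h6.add (hd.mul_left (1 / 3))).unique ?_
  have h7 := hasSum_ite_eq (0 : ℤ) (-(1 / 144) * (1 + 240 * e))
  convert! h7 using 1
  ext m
  by_cases hm : m = 0
  · simp [hm, laurentCoeff]
    ring
  · simp [hm, laurentCoeff]
    ring

/-- The `q`-expansion of `E₄`, with the divisor sums written as a double series. -/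
lemma E₄_eq_one_add {τ : UpperHalfPlane} {e : ℂ}
    (he : HasSum (fun k : ℕ => eulerian 3 (exp (2 * Real.pi * I * τ) ^ (k + 1))) e) :
    ModularForm.E₄ τ = 1 + 240 * e := by
  have hq : ‖exp (2 * Real.pi * I * τ)‖ < 1 := UpperHalfPlane.norm_exp_two_pi_I_lt_one τ
  have hsig := tsum_prod_pow_eq_tsum_sigma 3 hq
  rw [ModularForm.E₄, EisensteinSeries.q_expansion_bernoulli (by norm_num) (by decide)]
  simp only [zpow_natCast, Nat.reduceSub]
  rw [← hsig, bernoulli_eq_bernoulli'_of_ne_one (by decide), bernoulli'_four, ← he.tsum_eq,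
    tsum_pnat_eq_tsum_succ (f := fun d : ℕ => ∑' c : ℕ+, ((c : ℕ) : ℂ) ^ 3 *
      exp (2 * Real.pi * I * τ) ^ (d * (c : ℕ)))]
  have hterm (k : ℕ) : ∑' c : ℕ+, ((c : ℕ) : ℂ) ^ 3 *
      exp (2 * Real.pi * I * τ) ^ ((k + 1) * (c : ℕ))
        = eulerian 3 (exp (2 * Real.pi * I * τ) ^ (k + 1)) := by
    have hk : ‖exp (2 * Real.pi * I * τ) ^ (k + 1)‖ < 1 := by
      rw [norm_pow]; exact pow_lt_one₀ (norm_nonneg _) hq k.succ_ne_zero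
    rw [tsum_pnat_eq_tsum_succ (f := fun c : ℕ => (c : ℂ) ^ 3 *
      exp (2 * Real.pi * I * τ) ^ ((k + 1) * c)), ← (hasSum_eulerian_succ 3 (by decide) hk).tsum_eq]
    refine tsum_congr fun c => ?_
    rw [← pow_mul]
    simp
  simp only [hterm]
  norm_num

/-! ### Partial derivatives as a linear operator -/

/-- The partial derivative `∂ⁿ⁺ᵐ / ∂zⁿ ∂τᵐ` as an operator on functions of two variables. -/
def partialOp (n m : ℕ) (g : ℂ × ℂ → ℂ) : ℂ × ℂ → ℂ :=
  (dirDeriv (1, 0))^[n] ((dirDeriv (0, 1))^[m] g)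

lemma iterate_dirDeriv_add (w : ℂ × ℂ) (n : ℕ) {g g' : ℂ × ℂ → ℂ} {p : ℂ × ℂ}
    (hg : AnalyticAt ℂ g p) (hg' : AnalyticAt ℂ g' p) :
    (dirDeriv w)^[n] (fun v => g v + g' v) =ᶠ[𝓝 p]
      fun v => (dirDeriv w)^[n] g v + (dirDeriv w)^[n] g' v := by
  induction n generalizing g g' with
  | zero => exact .rfl
  | succ n ih =>
    refine (iterate_dirDeriv_congr w n ?_).trans
      (ih (analyticAt_dirDeriv w hg) (analyticAt_dirDeriv w hg'))
    filter_upwards [hg.eventually_analyticAt, hg'.eventually_analyticAt] with v h h'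
    simp only [dirDeriv]
    rw [fderiv_fun_add h.differentiableAt h'.differentiableAt, add_apply]

lemma iterate_dirDeriv_const_mul (w : ℂ × ℂ) (n : ℕ) (a : ℂ) {g : ℂ × ℂ → ℂ} {p : ℂ × ℂ}
    (hg : AnalyticAt ℂ g p) :
    (dirDeriv w)^[n] (fun v => a * g v) =ᶠ[𝓝 p] fun v => a * (dirDeriv w)^[n] g v := by
  induction n generalizing g with
  | zero => exact .rfl
  | succ n ih =>
    refine (iterate_dirDeriv_congr w n ?_).trans (ih (analyticAt_dirDeriv w hg))
    filter_upwards [hg.eventually_analyticAt] with v h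
    simp only [dirDeriv]
    rw [fderiv_const_mul h.differentiableAt]
    simp

lemma partialOp_add (n m : ℕ) {g g' : ℂ × ℂ → ℂ} {p : ℂ × ℂ}
    (hg : AnalyticAt ℂ g p) (hg' : AnalyticAt ℂ g' p) :
    partialOp n m (fun v => g v + g' v) p = partialOp n m g p + partialOp n m g' p :=
  ((iterate_dirDeriv_congr _ n (iterate_dirDeriv_add _ m hg hg')).trans
    (iterate_dirDeriv_add _ n (analyticAt_iterate_dirDeriv _ m hg)
      (analyticAt_iterate_dirDeriv _ m hg'))).eq_of_nhds

lemma partialOp_const_mul (n m : ℕ) (a : ℂ) {g : ℂ × ℂ → ℂ} {p : ℂ × ℂ}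
    (hg : AnalyticAt ℂ g p) :
    partialOp n m (fun v => a * g v) p = a * partialOp n m g p :=
  ((iterate_dirDeriv_congr _ n (iterate_dirDeriv_const_mul _ m a hg)).trans
    (iterate_dirDeriv_const_mul _ n a (analyticAt_iterate_dirDeriv _ m hg))).eq_of_nhds

lemma partialOp_congr (n m : ℕ) {g g' : ℂ × ℂ → ℂ} {p : ℂ × ℂ} (h : g =ᶠ[𝓝 p] g') :
    partialOp n m g p = partialOp n m g' p :=
  (iterate_dirDeriv_congr _ n (iterate_dirDeriv_congr _ m h)).eq_of_nhds

/-- The monomial `a zⁱ τʲ`. -/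
def monomialFun (a : ℂ) (i j : ℕ) (p : ℂ × ℂ) : ℂ := a * p.1 ^ i * p.2 ^ j

lemma analyticAt_monomialFun (a : ℂ) (i j : ℕ) (p : ℂ × ℂ) :
    AnalyticAt ℂ (monomialFun a i j) p :=
  (analyticAt_const.mul (analyticAt_fst.pow i)).mul (analyticAt_snd.pow j)

lemma dirDeriv_fst_monomialFun (a : ℂ) (i j : ℕ) :
    dirDeriv (1, 0) (monomialFun a i j) = monomialFun (a * i) (i - 1) j := by
  ext v
  have h := iteratedDeriv_comp_line (g := monomialFun a i j) (w := (1, 0))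
    (φ := fun s => (s, v.2)) (fun t => (hasDerivAt_id t).prodMk (hasDerivAt_const t v.2)) 1
    (t := v.1) (analyticAt_monomialFun a i j _)
  have h' : HasDerivAt (fun s => a * s ^ i * v.2 ^ j) (a * (i * v.1 ^ (i - 1)) * v.2 ^ j) v.1 :=
    ((hasDerivAt_pow i v.1).const_mul a).mul_const _
  refine h.symm.trans ?_
  rw [iteratedDeriv_one]
  refine h'.deriv.trans ?_
  rw [monomialFun]
  ring

lemma dirDeriv_snd_monomialFun (a : ℂ) (i j : ℕ) :
    dirDeriv (0, 1) (monomialFun a i j) = monomialFun (a * j) i (j - 1) := by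
  ext v
  have h := iteratedDeriv_comp_line (g := monomialFun a i j) (w := (0, 1))
    (φ := fun s => (v.1, s)) (fun t => (hasDerivAt_const t v.1).prodMk (hasDerivAt_id t)) 1
    (t := v.2) (analyticAt_monomialFun a i j _)
  have h' : HasDerivAt (fun s => a * v.1 ^ i * s ^ j) (a * v.1 ^ i * (j * v.2 ^ (j - 1))) v.2 :=
    (hasDerivAt_pow j v.2).const_mul _
  refine h.symm.trans ?_
  rw [iteratedDeriv_one]
  refine h'.deriv.trans ?_
  rw [monomialFun]
  ring

/-! ### The elliptic trilogarithm -/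

/-- The functional `(z, τ) ↦ 2πiz = log ζ`. -/
def logZeta : ℂ × ℂ →L[ℂ] ℂ := (2 * Real.pi * I : ℂ) • ContinuousLinearMap.fst ℂ ℂ ℂ

/-- The functional `(z, τ) ↦ 2πiτ = log q`. -/
def logQ : ℂ × ℂ →L[ℂ] ℂ := (2 * Real.pi * I : ℂ) • ContinuousLinearMap.snd ℂ ℂ ℂ

lemma logZeta_apply (v : ℂ × ℂ) : logZeta v = 2 * Real.pi * I * v.1 := by simp [logZeta]

lemma logQ_apply (v : ℂ × ℂ) : logQ v = 2 * Real.pi * I * v.2 := by simp [logQ]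

lemma re_two_pi_I_mul (z : ℂ) : (2 * Real.pi * I * z).re = -(2 * Real.pi * z.im) := by simp

lemma re_logQ_neg {v : ℂ × ℂ} (h : 0 < v.2.im) : (logQ v).re < 0 := by
  rw [logQ_apply, re_two_pi_I_mul]
  have := Real.pi_pos
  simpa using by positivity

lemma re_logZeta_neg {v : ℂ × ℂ} (h : 0 < v.1.im) : (logZeta v).re < 0 := by
  rw [logZeta_apply, re_two_pi_I_mul]
  have := Real.pi_pos
  simpa using by positivity

lemma re_logQ_sub_logZeta_neg {v : ℂ × ℂ} (h : v.1.im < v.2.im) :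
    ((logQ - logZeta) v).re < 0 := by
  rw [sub_apply, logQ_apply, logZeta_apply, ← mul_sub, re_two_pi_I_mul, Complex.sub_im]
  have := Real.pi_pos
  have h' : 0 < v.2.im - v.1.im := sub_pos.2 h
  simpa using by positivity

lemma isOpen_strip : IsOpen strip := by
  refine IsOpen.and ?_ ?_
  · exact isOpen_lt continuous_const (by fun_prop)
  · exact isOpen_lt (by fun_prop) (by fun_prop)

lemma chi_three (a b : ℂ) : chi 3 a b = -(1 / 12) * a ^ 3 + 1 / 24 * a ^ 2 * b - 1 / 720 * b ^ 3 := by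
  have h1 : bernoulli 1 = -1 / 2 := bernoulli_one
  have h2 : bernoulli 2 = 6⁻¹ := bernoulli_two
  have h3 : bernoulli 3 = 0 := bernoulli_eq_zero_of_odd (by decide) (by norm_num)
  have h4 : bernoulli 4 = -1 / 30 := by
    rw [bernoulli_eq_bernoulli'_of_ne_one (by decide), bernoulli'_four]
  simp [chi, Finset.sum_range_succ, h1, h2, h3, h4, Nat.factorial]
  ring

/-- The three trilogarithm series and the polynomial that make up `f`, up to the factor
`(2πi)⁻³`. -/
def fParts (p : ℂ × ℂ) : ℂ :=
  trilogSum logZeta logQ p + trilogSum (logQ - logZeta) logQ p + -2 * trilogSum logQ logQ p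
    + monomialFun ((2 * Real.pi * I) ^ 3 / 12) 3 0 p
    + monomialFun (-(2 * Real.pi * I) ^ 3 / 24) 2 1 p + monomialFun (-Li 3 1) 0 0 p

lemma fSeries_eq {p : ℂ × ℂ} (hp : p ∈ strip) :
    fSeries p = 1 / (2 * Real.pi * I) ^ 3 * fParts p := by
  obtain ⟨hz, hzt⟩ := hp
  have hq := re_logQ_neg (hz.trans hzt)
  have h1 := trilogSum_eq_tsum_Li (re_logZeta_neg hz) hq
  have h2 := trilogSum_eq_tsum_Li (re_logQ_sub_logZeta_neg hzt) hq
  have h3 := trilogSum_eq_tsum_Li hq hq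
  simp only [logZeta_apply, logQ_apply, sub_apply] at h1 h2 h3
  have e2 (m : ℕ) : exp (2 * Real.pi * I * p.2) ^ m *
      exp (2 * Real.pi * I * p.2 - 2 * Real.pi * I * p.1)
      = exp (2 * Real.pi * I * p.2) ^ (m + 1) * (exp (2 * Real.pi * I * p.1))⁻¹ := by
    rw [Complex.exp_sub, pow_succ, div_eq_mul_inv]
    ring
  simp only [e2, ← pow_succ] at h2 h3
  have h4 := (hasSum_nat_add_iff (f := fun m => Li 3 (exp (2 * Real.pi * I * p.2) ^ m)) 1).1 h3
  have t1 := h1.tsum_eq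
  have t2 := h2.tsum_eq
  have t3 := h3.tsum_eq
  have t4 := h4.tsum_eq
  simp only [Finset.range_one, Finset.sum_singleton, pow_zero] at t4
  simp only [fSeries, fParts, ellipticLi, mul_zero, Complex.exp_zero, mul_one, inv_one, chi_three,
    monomialFun, t1, t2, t3, t4]
  generalize (2 * Real.pi * I : ℂ) = c
  ring

lemma fSeries_eventuallyEq {p : ℂ × ℂ} (hp : p ∈ strip) :
    fSeries =ᶠ[𝓝 p] fun v => 1 / (2 * Real.pi * I) ^ 3 * fParts v := by
  filter_upwards [isOpen_strip.mem_nhds hp] with v hv using fSeries_eq hv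

lemma exp_ne_one_of_mem_offLattice {v : ℂ × ℂ} (hv : v ∈ offLattice) (m : ℕ) :
    exp (logZeta v + m * logQ v) ≠ 1 ∧ exp ((logQ - logZeta) v + m * logQ v) ≠ 1 := by
  have h2 : (2 * Real.pi * I : ℂ) ≠ 0 := Complex.two_pi_I_ne_zero
  simp only [sub_apply, logZeta_apply, logQ_apply, ne_eq, Complex.exp_eq_one_iff, not_exists]
  refine ⟨fun n hn => hv.2 n (-m) ?_, fun n hn => hv.2 (-n) (m + 1) ?_⟩
  · refine mul_left_cancel₀ h2 ?_
    push_cast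
    linear_combination hn
  · refine mul_left_cancel₀ h2 ?_
    push_cast
    linear_combination -hn

/-- The elliptic trilogarithm continues along every path that avoids the lattice. -/
lemma continuesAlong_fSeries {γ : C(unitInterval, ℂ × ℂ)} (h0 : γ 0 ∈ strip)
    (hγ : ∀ t, γ t ∈ offLattice) : ContinuesAlong fSeries γ := by
  have hq (t) : (logQ (γ t)).re < 0 := re_logQ_neg (hγ t).1
  have hmono (a : ℂ) (i j : ℕ) : ContinuesAlong (monomialFun a i j) γ :=
    continuesAlong_of_analyticAt fun t => analyticAt_monomialFun a i j _
  have h1 : ContinuesAlong (trilogSum logZeta logQ) γ :=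
    continuesAlong_trilogSum (re_logZeta_neg h0.1) hq
      fun t m => (exp_ne_one_of_mem_offLattice (hγ t) m).1
  have h2 : ContinuesAlong (trilogSum (logQ - logZeta) logQ) γ :=
    continuesAlong_trilogSum (re_logQ_sub_logZeta_neg h0.2) hq
      fun t m => (exp_ne_one_of_mem_offLattice (hγ t) m).2
  have h3 : ContinuesAlong (trilogSum logQ logQ) γ :=
    continuesAlong_of_analyticAt fun t => analyticAt_trilogSum (hq t) (hq t)
  exact ((((((h1.add h2).add (h3.const_mul (-2))).add (hmono _ 3 0)).add (hmono _ 2 1)).add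
    (hmono _ 0 0)).const_mul _).congr (fSeries_eventuallyEq h0).symm

lemma partialOp_fSeries (n m : ℕ) {v : ℂ × ℂ} (hv : v ∈ strip) :
    partialOp n m fSeries v = 1 / (2 * Real.pi * I) ^ 3 *
      (partialOp n m (trilogSum logZeta logQ) v + partialOp n m (trilogSum (logQ - logZeta) logQ) v
        + -2 * partialOp n m (trilogSum logQ logQ) v
        + partialOp n m (monomialFun ((2 * Real.pi * I) ^ 3 / 12) 3 0) v
        + partialOp n m (monomialFun (-(2 * Real.pi * I) ^ 3 / 24) 2 1) v
        + partialOp n m (monomialFun (-Li 3 1) 0 0) v) := by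
  have hq : (logQ v).re < 0 := re_logQ_neg (hv.1.trans hv.2)
  have a1 := analyticAt_trilogSum (re_logZeta_neg hv.1) hq
  have a2 := analyticAt_trilogSum (re_logQ_sub_logZeta_neg hv.2) hq
  have a3 := analyticAt_trilogSum hq hq
  have a3' := (analyticAt_const (v := (-2 : ℂ))).mul a3
  have b1 := analyticAt_monomialFun ((2 * Real.pi * I) ^ 3 / 12) 3 0 v
  have b2 := analyticAt_monomialFun (-(2 * Real.pi * I) ^ 3 / 24) 2 1 v
  have b3 := analyticAt_monomialFun (-Li 3 1) 0 0 v
  have c1 := a1.add a2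
  have c2 := c1.add a3'
  have c3 := c2.add b1
  have c4 := c3.add b2
  rw [partialOp_congr n m (fSeries_eventuallyEq hv)]
  refine (partialOp_const_mul n m _ (c4.add b3)).trans ?_
  congr 1
  refine (partialOp_add n m c4 b3).trans ?_
  congr 1
  refine (partialOp_add n m c3 b2).trans ?_
  congr 1
  refine (partialOp_add n m c2 b1).trans ?_
  congr 1
  refine (partialOp_add n m c1 a3').trans ?_
  congr 1
  · exact partialOp_add n m a1 a2
  · exact partialOp_const_mul n m _ a3

/-- The two series that depend on `ζ` contribute the coefficients with `j > 0` and `j < 0`. -/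
lemma hasSum_laurent_partialOp {v : ℂ × ℂ} (hv : v ∈ strip) {n : ℕ} {r : Fin 4}
    (hn : n + (r : ℕ) = 3) (c : ℂ) :
    HasSum (fun j : ℤ => laurentCoeff (exp (logQ v)) r c j * exp (logZeta v) ^ j)
      (c + 1 / (2 * Real.pi * I) ^ 3 * (partialOp n r (trilogSum logZeta logQ) v
        + partialOp n r (trilogSum (logQ - logZeta) logQ) v)) := by
  have hq : (logQ v).re < 0 := re_logQ_neg (hv.1.trans hv.2)
  have hq1 : ‖exp (logQ v)‖ < 1 := by
    rw [Complex.norm_exp]; exact Real.exp_lt_one_iff.mpr hq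
  have h2 : (2 * Real.pi * I : ℂ) ≠ 0 := Complex.two_pi_I_ne_zero
  have hpow : (2 * Real.pi * I : ℂ) ^ 3 = (2 * Real.pi * I) ^ n * (2 * Real.pi * I) ^ (r : ℕ) := by
    rw [← pow_add, hn]
  have hsign : (-1 : ℂ) ^ n = (-1) ^ ((r : ℕ) + 1) := by
    have : n = 3 - (r : ℕ) := by omega
    subst this
    fin_cases r <;> norm_num
  have k1 := (hasSum_iterate_dirDeriv_trilogSum (re_logZeta_neg hv.1) hq (1, 0) (0, 1) hn).mul_left
    (1 / (2 * Real.pi * I) ^ 3)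
  have k2 := (hasSum_iterate_dirDeriv_trilogSum (re_logQ_sub_logZeta_neg hv.2) hq (1, 0) (0, 1)
    hn).mul_left ((-1) ^ n * (1 / (2 * Real.pi * I) ^ 3))
  have key := hasSum_laurent (Complex.exp_ne_zero _) hq1 r c (ζ := exp (logZeta v))
    (s₁ := 1 / (2 * Real.pi * I) ^ 3 * partialOp n r (trilogSum logZeta logQ) v)
    (s₂ := (-1) ^ n * (1 / (2 * Real.pi * I) ^ 3) *
      partialOp n r (trilogSum (logQ - logZeta) logQ) v) ?_ ?_
  · convert! key using 1
    have : (-1 : ℂ) ^ ((r : ℕ) + 1) * (-1) ^ ((r : ℕ) + 1) = 1 := by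
      rw [← mul_pow]; norm_num
    rw [hsign]
    linear_combination (-(1 / (2 * Real.pi * I) ^ 3 *
      partialOp n r (trilogSum (logQ - logZeta) logQ) v)) * this
  · convert! k1 using 1
    ext p
    have e : exp ((p.2 + 1) * (logZeta v + p.1 * logQ v))
        = (exp (logZeta v) * exp (logQ v) ^ p.1) ^ (p.2 + 1) := by
      rw [← Complex.exp_nat_mul, ← Complex.exp_add, ← Complex.exp_nat_mul]
      push_cast
      rfl
    rw [e, hpow]
    simp only [logZeta_apply, logQ_apply, mul_one, mul_zero, add_zero, zero_add, mul_pow]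
    field_simp
  · convert! k2 using 1
    ext p
    have e : exp ((p.2 + 1) * ((logQ - logZeta) v + p.1 * logQ v))
        = (exp (logQ v) ^ (p.1 + 1) * (exp (logZeta v))⁻¹) ^ (p.2 + 1) := by
      rw [← Complex.exp_neg, ← Complex.exp_nat_mul, ← Complex.exp_add, ← Complex.exp_nat_mul,
        sub_apply]
      push_cast
      ring_nf
    have hs : ((-1 : ℂ) ^ n) * (-1) ^ n = 1 := by rw [← mul_pow]; norm_num
    have e1 : (logQ - logZeta) (1, 0) + p.1 * logQ (1, 0) = -1 * (2 * Real.pi * I) := by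
      simp [logZeta_apply, logQ_apply]
    have e2 : (logQ - logZeta) (0, 1) + p.1 * logQ (0, 1) = (p.1 + 1) * (2 * Real.pi * I) := by
      simp [logZeta_apply, logQ_apply]
      ring
    rw [e, e1, e2, hpow, mul_pow (-1 : ℂ), mul_pow ((p.1 : ℂ) + 1)]
    field_simp
    linear_combination -hs

lemma partialOp_trilogSum_logQ_eq_zero {v : ℂ × ℂ} (hv : 0 < v.2.im) {n m : ℕ} (hn : n ≠ 0)
    (hnm : n + m = 3) : partialOp n m (trilogSum logQ logQ) v = 0 := by
  have hq := re_logQ_neg hv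
  have h := hasSum_iterate_dirDeriv_trilogSum hq hq (1, 0) (0, 1) hnm
  refine h.unique ?_
  simp [logQ_apply, hn]

/-- The constant terms `1/2`, `-1/12`, `0`, `-2e` of the Laurent series of the third derivatives
come from the regularizing polynomial and from the value at `ζ = 1`. -/
lemma pdeDefect_fSeries {v : ℂ × ℂ} (hv : v ∈ strip) : pdeDefect fSeries v = 0 := by
  have hτ : 0 < v.2.im := hv.1.trans hv.2
  have hq : (logQ v).re < 0 := re_logQ_neg hτ
  have hq1 : ‖exp (logQ v)‖ < 1 := by
    rw [Complex.norm_exp]; exact Real.exp_lt_one_iff.mpr hq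
  have hζ1 : ‖exp (logZeta v)‖ < 1 := by
    rw [Complex.norm_exp]; exact Real.exp_lt_one_iff.mpr (re_logZeta_neg hv.1)
  have hc : (2 * Real.pi * I : ℂ) ≠ 0 := Complex.two_pi_I_ne_zero
  set e : ℂ := 1 / (2 * Real.pi * I) ^ 3 * partialOp 0 3 (trilogSum logQ logQ) v with he
  have hE : HasSum (fun k : ℕ => eulerian 3 (exp (logQ v) ^ (k + 1))) e := by
    have h := (hasSum_iterate_dirDeriv_trilogSum hq hq (1, 0) (0, 1) (n := 0) (m := 3)
      rfl).mul_left (1 / (2 * Real.pi * I) ^ 3)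
    refine ((Equiv.prodComm ℕ ℕ).hasSum_iff.2 h).prod_fiberwise fun k => ?_
    have hk : ‖exp (logQ v) ^ (k + 1)‖ < 1 := by
      rw [norm_pow]; exact pow_lt_one₀ (norm_nonneg _) hq1 k.succ_ne_zero
    convert! hasSum_eulerian_succ 3 (by decide) hk using 1
    ext m
    have e1 : exp (((k : ℂ) + 1) * (logQ v + m * logQ v)) = (exp (logQ v) ^ (k + 1)) ^ (m + 1) := by
      rw [← Complex.exp_nat_mul, ← Complex.exp_nat_mul]
      push_cast
      ring_nf
    have e2 : logQ (0, 1) + m * logQ (0, 1) = (m + 1) * (2 * Real.pi * I) := by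
      rw [logQ_apply]
      ring
    simp only [Function.comp_apply, Equiv.prodComm_apply, Prod.swap]
    rw [e1, e2, mul_pow]
    change _ = ((m : ℂ) + 1) ^ 3 * _
    field_simp
  have h0 : HasSum (fun j : ℤ => laurentCoeff (exp (logQ v)) 0 (1 / 2) j * exp (logZeta v) ^ j)
      (partialOp 3 0 fSeries v) := by
    convert! hasSum_laurent_partialOp hv (n := 3) (r := 0) rfl (1 / 2) using 1
    rw [partialOp_fSeries 3 0 hv, partialOp_trilogSum_logQ_eq_zero hτ (by norm_num) rfl]
    simp [partialOp, dirDeriv_fst_monomialFun, monomialFun]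
    field_simp
    ring
  have h1 : HasSum (fun j : ℤ => laurentCoeff (exp (logQ v)) 1 (-1 / 12) j * exp (logZeta v) ^ j)
      (partialOp 2 1 fSeries v) := by
    convert! hasSum_laurent_partialOp hv (n := 2) (r := 1) rfl (-1 / 12) using 1
    rw [partialOp_fSeries 2 1 hv, partialOp_trilogSum_logQ_eq_zero hτ (by norm_num) rfl]
    simp [partialOp, dirDeriv_fst_monomialFun, dirDeriv_snd_monomialFun, monomialFun]
    field_simp
    ring
  have h2 : HasSum (fun j : ℤ => laurentCoeff (exp (logQ v)) 2 0 j * exp (logZeta v) ^ j)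
      (partialOp 1 2 fSeries v) := by
    convert! hasSum_laurent_partialOp hv (n := 1) (r := 2) rfl 0 using 1
    rw [partialOp_fSeries 1 2 hv, partialOp_trilogSum_logQ_eq_zero hτ (by norm_num) rfl]
    simp [partialOp, dirDeriv_fst_monomialFun, dirDeriv_snd_monomialFun, monomialFun]
  have h3 : HasSum (fun j : ℤ => laurentCoeff (exp (logQ v)) 3 (-2 * e) j * exp (logZeta v) ^ j)
      (partialOp 0 3 fSeries v) := by
    convert! hasSum_laurent_partialOp hv (n := 0) (r := 3) rfl (-2 * e) using 1
    rw [partialOp_fSeries 0 3 hv, he]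
    have hz (a : ℂ) (i j : ℕ) (hj : j < 3) : partialOp 0 3 (monomialFun a i j) v = 0 := by
      interval_cases j <;> simp [partialOp, dirDeriv_snd_monomialFun, monomialFun]
    rw [hz _ _ _ (by norm_num), hz _ _ _ (by norm_num), hz _ _ _ (by norm_num)]
    change _ = -2 * _ + _ * (partialOp 0 3 _ v + partialOp 0 3 _ v)
    ring
  have hmain := laurent_identity (Complex.exp_ne_zero _) hq1 (Complex.exp_ne_zero _) hζ1
    h0 h1 h2 h3 hE
  have hτ' : ((UpperHalfPlane.ofComplex v.2 : UpperHalfPlane) : ℂ) = v.2 := by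
    rw [UpperHalfPlane.ofComplex_apply_of_im_pos hτ]
  have hE4 := E₄_eq_one_add (τ := UpperHalfPlane.ofComplex v.2) (e := e)
    (by rw [hτ', ← logQ_apply]; exact hE)
  have hdef : pdeDefect fSeries v = partialOp 3 0 fSeries v * partialOp 1 2 fSeries v
      - partialOp 2 1 fSeries v ^ 2 + 1 / 3 * partialOp 0 3 fSeries v
      + 1 / 144 * ModularForm.E₄ (UpperHalfPlane.ofComplex v.2) := rfl
  rw [hdef, hE4]
  linear_combination hmain

end EllipticTrilog
end
theorem theorem1 :
    -- `f` is a multivalued analytic function of `(z, τ)`, where `z` is not in `ℤ + ℤτ`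
    (∀ γ : C(unitInterval, ℂ × ℂ), γ 0 ∈ EllipticTrilog.strip →
      (∀ t, γ t ∈ EllipticTrilog.offLattice) →
        ∃ F, EllipticTrilog.IsContinuationAlong EllipticTrilog.fSeries γ F) ∧
    -- and every branch of it satisfies the differential equation
    (∀ (z : ℂ) (τ : UpperHalfPlane) (f : ℂ × ℂ → ℂ), EllipticTrilog.IsBranch f (z, (τ : ℂ)) →
      EllipticTrilog.partialDeriv 3 0 f z τ * EllipticTrilog.partialDeriv 1 2 f z τ
          - EllipticTrilog.partialDeriv 2 1 f z τ ^ 2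
          + 1 / 3 * EllipticTrilog.partialDeriv 0 3 f z τ
        = -(1 / 144) * ModularForm.E₄ τ) := by
  refine ⟨fun γ h0 hγ => ?_, fun z τ f hf => ?_⟩
  · obtain ⟨F, h1, h2, h3⟩ := EllipticTrilog.continuesAlong_fSeries h0 hγ
    exact ⟨F, h1, h2, h3⟩
  · obtain ⟨γ, F, h0, hγ, h1, hF, hFf⟩ := hf
    have hstrip : EllipticTrilog.pdeDefect EllipticTrilog.fSeries =ᶠ[nhds (γ 0)] 0 := by
      filter_upwards [EllipticTrilog.isOpen_strip.mem_nhds h0] with v hv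
      exact EllipticTrilog.pdeDefect_fSeries hv
    have hend := EllipticTrilog.pdeDefect_eventuallyEq_zero hF (fun t => (hγ t).1) hstrip 1
    have han := hF.analyticAt 1
    rw [h1] at hend han
    have hfan : AnalyticAt ℂ f (z, (τ : ℂ)) := han.congr hFf
    have key : EllipticTrilog.pdeDefect f (z, (τ : ℂ)) = 0 :=
      ((EllipticTrilog.pdeDefect_congr hFf).symm.trans hend).eq_of_nhds
    simp only [EllipticTrilog.partialDeriv_eq _ _ hfan]
    rw [EllipticTrilog.pdeDefect, UpperHalfPlane.ofComplex_apply] at key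
    simp only [Function.iterate_zero, id, Function.iterate_one] at key ⊢
    linear_combination key
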